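/- \textbf{Setting.} Let $E$ be a real ordered Banach space whose closed positive cone $E_+$ is generating ($E=E_+-E_+$) and on which the norm is additive: $\|u+v\|=\|u\|+\|v\|$ for $u,v\in E_+$. Let $(U(t,s))_{t\ge s\ge 0}$ be an evolution family on $E$, i.e. bounded operators such that $(t,s)\mapsto U(t,s)u$ is continuous on $\{t\ge s\ge0\}$ for each $u\in E$, $U(t,s)=U(t,r)U(r,s)$ and $U(t,t)=I$ for $t\ge r\ge s\ge0$, and $\|U(t,s)\|\le Ce^{\beta(t-s)}$ for some $C,\beta>0$. Let $(B(t))_{t\ge0}$ be a family of (unbounded) linear operators in $E$ with domains $D(B(t))$. Assume: (i) $U(t,s)u\in E_+$ and $\|U(t,s)u\|\le\|u\|$ for $u\in E_+$, $t\ge s\ge0$; (ii) $B(t)u\in E_+$ for $u\in D(B(t))\cap E_+$, $t\ge 0$; (iii) for all $u\in E$, $s\ge0$, one has $U(t,s)u\in D(B(t))$ for a.e. $t\ge s$, and $t\mapsto B(t)U(t,s)u$ is (strongly, Lebesgue) measurable on $[s,\infty)$; and for $u\in E_+$, $t\ge s\ge 0$, $$\int_s^t\|B(\tau)U(\tau,s)u\|\,d\tau\le\|u\|-\|U(t,s)u\|;$$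 (iv) for every $f\in X:=L^1(\mathbb R_+,E)$ the map $(t,s)\mapsto B(t)U(t,s)f(s)$ is defined almost everywhere on $\Delta=\{0\le s\le t\}$ and (strongly, Lebesgue) measurable. Let $X_+=\{f\in X: f(s)\in E_+\text{ for a.e. }s\ge 0\}$. For $t\ge s\ge 0$ and $u\in E$ put $V_0(t,s)=U(t,s)$, $V_{n+1}(t,s)u=\int_s^tV_n(t,r)B(r)U(r,s)u\,dr$ and $V(t,s)u=\sum_{n\ge0}V_n(t,s)u$. For $t\ge0$ and $f\in X$ let $[T_0(t)f](s)=U(s,s-t)f(s-t)$ and $[T(t)f](s)=V(s,s-t)f(s-t)$ for a.e. $s\ge t$, and $[T_0(t)f](s)=[T(t)f](s)=0$ for $0\le s<t$. For $\lambda>0$ let $$[\mathfrak B_\lambda f](s)=\int_0^s e^{-\lambda(s-\tau)}B(s)U(s,\tau)f(\tau)\,d\tau\qquad\text{for a.e. }s\ge0.$$ \textbf{Theorem.} All these objects are well defined: the integrals defining $V_{n+1}(t,s)u$ and (for a.e. $s$) $[\mathfrak B_\lambda f](s)$ exist and the series for $V(t,s)u$ converges; $\mathfrak B_\lambda$, $T_0(t)$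 and $T(t)$ are bounded operators on $X$; $(T_0(t))_{t\ge0}$ and $(T(t))_{t\ge0}$ are $C_0$-semigroups, with generators denoted by $(Z,D(Z))$ and $(G,D(G))$; and there is a unique bounded linear functional $\Psi$ on $X$ with $\langle\Psi,f\rangle=\|f\|_X$ for all $f\in X_+$. Moreover $D(Z)\subset D(G)$, and the operator $\widehat B:=G-Z$ with domain $D(\widehat B)=D(Z)$ has the following properties. \begin{enumerate} \item $\widehat B$ is $Z$-bounded: there are $a,b\ge0$ with $\|\widehat Bf\|\le a\|Zf\|+b\|f\|$ for all $f\in D(Z)$. \item $\widehat Bf=\lim_{\lambda\to\infty}\lambda\mathfrak B_\lambda f$ in $X$ for every $f\in D(Z)$. \item $\widehat Bf\in X_+$ for every $f\in D(Z)\cap X_+$. \item $\langle\Psi,(Z+\widehat B)f\rangle\le0$ for every $f\in D(Z)\cap X_+$. \item For all $f\in D(Z)$ and $t\ge0$: $T_0(s)f\in D(Z)$ for all $s\ge0$, the function $s\mapsto T(t-s)\widehat BT_0(s)f$ is integrable on $[0,t]$, and $$T(t)f=T_0(t)f+\int_0^tT(t-s)\widehat BT_0(s)f\,ds.$$ \end{enumerate}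 -/

import Mathlib

open MeasureTheory Set Filter Topology

noncomputable section

/-- Together with the order instances, this says that `E` is an abstract state space: a real
ordered Banach space (with closed positive cone) whose positive cone is generating and
on whose positive cone the norm is additive. -/
structure IsAbstractStateSpace (E : Type*) [NormedAddCommGroup E] [PartialOrder E] : Prop where
  generating : ∀ u : E, ∃ v w : E, 0 ≤ v ∧ 0 ≤ w ∧ u = v - w
  norm_add : ∀ u v : E, 0 ≤ u → 0 ≤ v → ‖u + v‖ = ‖u‖ + ‖v‖

/-- The value of an unbounded operator at `u`, set to `0` when `u` is outside the domain. It is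
used for functions whose values lie in the domain almost everywhere. -/
def LinearPMap.val {F : Type*} [AddCommGroup F] [Module ℝ F] (A : F →ₗ.[ℝ] F) (u : F) : F :=
  open Classical in if h : u ∈ A.domain then A ⟨u, h⟩ else 0

section EvolutionFamilies

variable {E : Type*} [NormedAddCommGroup E] [NormedSpace ℝ E]

/-- The index set `Δ = {(t, s) : 0 ≤ s ≤ t}` of an evolution family. -/
def evolutionIndex : Set (ℝ × ℝ) := {p | 0 ≤ p.2 ∧ p.2 ≤ p.1}

/-- `(U(t,s))_{t ≥ s ≥ 0}` is an evolution family on `E`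
(nothing is said about the values of `U` outside `t ≥ s ≥ 0`). -/
structure IsEvolutionFamily (U : ℝ → ℝ → E →L[ℝ] E) : Prop where
  continuousOn : ∀ u : E, ContinuousOn (fun p : ℝ × ℝ => U p.1 p.2 u) evolutionIndex
  comp : ∀ t r s : ℝ, 0 ≤ s → s ≤ r → r ≤ t → U t s = (U t r).comp (U r s)
  refl : ∀ t : ℝ, 0 ≤ t → U t t = ContinuousLinearMap.id ℝ E
  exp_bound : ∃ C β : ℝ, 0 < C ∧ 0 < β ∧
    ∀ t s : ℝ, 0 ≤ s → s ≤ t → ‖U t s‖ ≤ C * Real.exp (β * (t - s))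

/-- The standing assumptions on the unperturbed evolution family `U` and on the family `B` of
unbounded operators. -/
structure IsPerturbedFamily [PartialOrder E]
    (U : ℝ → ℝ → E →L[ℝ] E) (B : ℝ → E →ₗ.[ℝ] E) : Prop where
  evolution : IsEvolutionFamily U
  nonneg : ∀ t s : ℝ, 0 ≤ s → s ≤ t → ∀ u : E, 0 ≤ u → 0 ≤ U t s u
  norm_le : ∀ t s : ℝ, 0 ≤ s → s ≤ t → ∀ u : E, 0 ≤ u → ‖U t s u‖ ≤ ‖u‖
  B_nonneg : ∀ t : ℝ, 0 ≤ t → ∀ u : (B t).domain, 0 ≤ (u : E) → 0 ≤ B t u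
  mem_domain : ∀ s : ℝ, 0 ≤ s → ∀ u : E,
    ∀ᵐ t ∂(volume.restrict (Ici s)), U t s u ∈ (B t).domain
  measurable : ∀ s : ℝ, 0 ≤ s → ∀ u : E,
    AEStronglyMeasurable (fun t => (B t).val (U t s u)) (volume.restrict (Ici s))
  lintegral_le : ∀ t s : ℝ, 0 ≤ s → s ≤ t → ∀ u : E, 0 ≤ u →
    ∫⁻ τ in Icc s t, ‖(B τ).val (U τ s u)‖ₑ ≤ ENNReal.ofReal (‖u‖ - ‖U t s u‖)

/-- The Dyson–Phillips iterates: `V₀(t,s) = U(t,s)` and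
`V_{n+1}(t,s)u = ∫_s^t V_n(t,r) B(r) U(r,s) u dr`. -/
def dysonPhillips (U : ℝ → ℝ → E →L[ℝ] E) (B : ℝ → E →ₗ.[ℝ] E) : ℕ → ℝ → ℝ → E → E
  | 0, t, s, u => U t s u
  | n + 1, t, s, u => ∫ r in s..t, dysonPhillips U B n t r ((B r).val (U r s u))

/-- The perturbed evolution family `V(t,s)u = ∑ₙ V_n(t,s)u`. -/
def perturbedFamily (U : ℝ → ℝ → E →L[ℝ] E) (B : ℝ → E →ₗ.[ℝ] E) (t s : ℝ) (u : E) : E :=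
  ∑' n, dysonPhillips U B n t s u

end EvolutionFamilies

/-- Lebesgue measure on `ℝ₊ = [0, ∞)`. -/
def halfLineMeasure : Measure ℝ := volume.restrict (Ici 0)

/-- The lifted space `X = L¹(ℝ₊, E)`. -/
abbrev LiftedSpace (E : Type*) [NormedAddCommGroup E] : Type _ := Lp E 1 halfLineMeasure

section LiftedSpace

variable {E : Type*} [NormedAddCommGroup E] [NormedSpace ℝ E]

/-- The positive cone `X₊` of the lifted space. -/
def liftedCone (E : Type*) [NormedAddCommGroup E] [PartialOrder E] : Set (LiftedSpace E) :=
  {f | ∀ᵐ s ∂halfLineMeasure, 0 ≤ f s}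

/-- The additional assumption: for all `f ∈ X`, the map `(t,s) ↦ B(t)U(t,s)f(s)` is defined
almost everywhere on `Δ` and measurable. -/
def IsJointlyMeasurable (U : ℝ → ℝ → E →L[ℝ] E) (B : ℝ → E →ₗ.[ℝ] E) : Prop :=
  ∀ f : LiftedSpace E,
    (∀ᵐ p ∂((volume : Measure (ℝ × ℝ)).restrict evolutionIndex),
      U p.1 p.2 (f p.2) ∈ (B p.1).domain) ∧
    AEStronglyMeasurable (fun p : ℝ × ℝ => (B p.1).val (U p.1 p.2 (f p.2)))
      ((volume : Measure (ℝ × ℝ)).restrict evolutionIndex)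

/-- `L` is the bounded operator on `X` given by the pointwise formula `f ↦ Φ f`. -/
def IsGivenBy (L : LiftedSpace E →L[ℝ] LiftedSpace E) (Φ : LiftedSpace E → ℝ → E) : Prop :=
  ∀ f : LiftedSpace E, L f =ᵐ[halfLineMeasure] Φ f

/-- The bounded operator on `X` given by the pointwise formula `f ↦ Φ f` (it is unique if it
exists; the value is `0` if there is none). -/
def operatorOf (Φ : LiftedSpace E → ℝ → E) : LiftedSpace E →L[ℝ] LiftedSpace E :=
  open Classical in if h : ∃ L, IsGivenBy L Φ then h.choose else 0

/-- `(t, f) ↦ (s ↦ W(s, s - t) f(s - t)` for `s ≥ t`, and `0` for `s < t)`. -/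
def evolutionFormula (W : ℝ → ℝ → E → E) (t : ℝ) (f : LiftedSpace E) (s : ℝ) : E :=
  open Classical in if t ≤ s then W s (s - t) (f (s - t)) else 0

/-- The evolution semigroup on `X` associated with the family `W`. -/
def evolutionSemigroup (W : ℝ → ℝ → E → E) (t : ℝ) : LiftedSpace E →L[ℝ] LiftedSpace E :=
  operatorOf (evolutionFormula W t)

/-- `s ↦ ∫_0^s exp(-l (s - τ)) B(s) U(s,τ) f(τ) dτ`. -/
def resolventFormula (U : ℝ → ℝ → E →L[ℝ] E) (B : ℝ → E →ₗ.[ℝ] E) (l : ℝ)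
    (f : LiftedSpace E) (s : ℝ) : E :=
  ∫ τ in (0 : ℝ)..s, Real.exp (-l * (s - τ)) • (B s).val (U s τ (f τ))

/-- The bounded operators `𝔅_l` on `X`. -/
def resolventPerturbation (U : ℝ → ℝ → E →L[ℝ] E) (B : ℝ → E →ₗ.[ℝ] E) (l : ℝ) :
    LiftedSpace E →L[ℝ] LiftedSpace E :=
  operatorOf (resolventFormula U B l)

end LiftedSpace

section Semigroups

variable {F : Type*} [NormedAddCommGroup F] [NormedSpace ℝ F]

/-- `(T(t))_{t ≥ 0}` is a `C₀`-semigroup (values at negative times are irrelevant). -/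
structure IsC0Semigroup (T : ℝ → F →L[ℝ] F) : Prop where
  zero : T 0 = ContinuousLinearMap.id ℝ F
  add : ∀ t s : ℝ, 0 ≤ t → 0 ≤ s → T (t + s) = (T t).comp (T s)
  continuousOn : ∀ f : F, ContinuousOn (fun t => T t f) (Ici 0)

/-- `g = lim_{t → 0+} t⁻¹ (T(t) f - f)`. -/
def HasGeneratorValue (T : ℝ → F →L[ℝ] F) (f g : F) : Prop :=
  Tendsto (fun t : ℝ => t⁻¹ • (T t f - f)) (𝓝[>] 0) (𝓝 g)

theorem HasGeneratorValue.add {T : ℝ → F →L[ℝ] F} {f g f' g' : F}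
    (h : HasGeneratorValue T f g) (h' : HasGeneratorValue T f' g') :
    HasGeneratorValue T (f + f') (g + g') := by
  refine (Tendsto.add h h').congr fun t => ?_
  rw [map_add, ← smul_add]
  congr 1
  abel

theorem HasGeneratorValue.smul {T : ℝ → F →L[ℝ] F} {f g : F} (c : ℝ)
    (h : HasGeneratorValue T f g) : HasGeneratorValue T (c • f) (c • g) := by
  refine (Tendsto.const_smul h c).congr fun t => ?_
  rw [map_smul, ← smul_sub, smul_comm]

theorem HasGeneratorValue.zero (T : ℝ → F →L[ℝ] F) : HasGeneratorValue T 0 0 := by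
  unfold HasGeneratorValue
  simp

/-- The generator of `(T(t))_{t ≥ 0}`, with domain the set of all `f` for which the limit of
`t⁻¹ (T(t) f - f)` as `t → 0+` exists. -/
def generator (T : ℝ → F →L[ℝ] F) : F →ₗ.[ℝ] F where
  domain :=
    { carrier := {f | ∃ g, HasGeneratorValue T f g}
      add_mem' := fun ⟨g, hg⟩ ⟨g', hg'⟩ => ⟨g + g', hg.add hg'⟩
      zero_mem' := ⟨0, HasGeneratorValue.zero T⟩
      smul_mem' := fun c _ ⟨g, hg⟩ => ⟨c • g, hg.smul c⟩ }
  toFun :=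
    { toFun := fun f => f.2.choose
      map_add' := fun f f' => tendsto_nhds_unique (f + f').2.choose_spec
        (HasGeneratorValue.add f.2.choose_spec f'.2.choose_spec)
      map_smul' := fun c f => tendsto_nhds_unique (c • f).2.choose_spec
        (HasGeneratorValue.smul c f.2.choose_spec) }

theorem generator_spec (T : ℝ → F →L[ℝ] F) (f : (generator T).domain) :
    HasGeneratorValue T f (generator T f) :=
  f.2.choose_spec

/-- The operator `G - Z` with domain `D(Z)`, where `D(Z) ⊆ D(G)`. -/
def differenceOperator (G Z : F →ₗ.[ℝ] F) (h : Z.domain ≤ G.domain) : F →ₗ.[ℝ] F where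
  domain := Z.domain
  toFun := G.toFun.comp (Submodule.inclusion h) - Z.toFun

/-- `A`, with `D(Z) ⊆ D(A)`, is `Z`-bounded. -/
def IsRelativelyBounded (A Z : F →ₗ.[ℝ] F) : Prop :=
  ∃ _ : Z.domain ≤ A.domain, ∃ a b : ℝ, 0 ≤ a ∧ 0 ≤ b ∧
    ∀ f ∈ Z.domain, ‖A.val f‖ ≤ a * ‖Z.val f‖ + b * ‖f‖

end Semigroups

end

/-!
The argument compares resolvents. All estimates on `E` come from one fact: for `u ≥ 0` the integral
of `‖B(r)U(r,s)u‖` over `[s, t]` is at most the mass `‖u‖ - ‖U(t,s)u‖` lost by `U`. Since the cone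
is generating and closed, every `u` is a difference of positive elements of norm at most `M ‖u‖`
(`exists_hasDecomposition`), so bounds on the cone extend to `E` with the factor `M`.

By induction the Dyson–Phillips iterates are positive, contractive on the cone and jointly strongly
continuous, and the norms of `V_n(t,s)u` with `n ≥ 1` add up to at most the mass lost by `U`
(`sum_norm_dysonPhillips_succ_le`). Hence the series for `V` converges, `V` is bounded, and
`V(t,s)u → u` at the diagonal (`tendsto_perturbedFamily_diagonal`). The Cauchy product of the
iterates gives the evolution law of `V`, and summation gives Duhamel's formula
`V(t,s)u = U(t,s)u + ∫ₛᵗ V(t,r)B(r)U(r,s)u dr`. Joint continuity of `V` is not needed: a bounded,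
measurable evolution family that is continuous at the diagonal induces a `C₀`-semigroup on `L¹`
(`IsMeasurableEvolution.isC0Semigroup`).

The resolvents of `T₀` and `T` are the Laplace transforms of the semigroups, and pointwise they are
Volterra integrals with kernels `exp(-l (s - τ)) U(s,τ)` and `exp(-l (s - τ)) V(s,τ)`
(`IsMeasurableEvolution.laplaceTransform_ae_eq`). Duhamel's formula and Fubini's theorem give
`R_T = R_{T₀} + R_T 𝔅_l` (`laplaceTransform_perturbed`). For `f ∈ D(Z)` and `g = l f - Z f` one has
`f = R_{T₀} g = R_T (g - 𝔅_l g)`, so `f ∈ D(G)` and `G f = Z f + 𝔅_l (l f - Z f)` for every `l > 0`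
(`hasGeneratorValue_perturbed`), that is, `B̂ f = 𝔅_l (l f - Z f)`.

The claims about `B̂` follow. It is `Z`-bounded because `𝔅_1` is bounded. As `l → ∞`, `𝔅_l Z f → 0`
by dominated convergence, so `l 𝔅_l f → B̂ f`, and positivity of `𝔅_l` passes to `B̂`. Differentiating
`‖T(t)f‖ ≤ ‖f‖` at `t = 0` for positive `f` gives the sign of `⟨Ψ, G f⟩`. Finally
`s ↦ T(t - s)T₀(s)f` has the continuous right derivative `-T(t - s) B̂ T₀(s) f`, which integrates to
Duhamel's formula for the semigroups (`IsC0Semigroup.duhamel`).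
-/

/-! ### Bounded decompositions and the functional extending the norm of the cone -/

section Cone

variable {E : Type*} [NormedAddCommGroup E] [NormedSpace ℝ E] [PartialOrder E]

/-- `M` is a decomposition constant of `E`: every `u` is a difference of positive elements whose
norms add up to at most `M ‖u‖`. -/
def HasDecomposition (E : Type*) [NormedAddCommGroup E] [PartialOrder E] (M : ℝ) : Prop :=
  0 ≤ M ∧ ∀ u : E, ∃ v w : E, 0 ≤ v ∧ 0 ≤ w ∧ u = v - w ∧ ‖v‖ + ‖w‖ ≤ M * ‖u‖

/-- A closed generating cone admits bounded decompositions. The map `c ↦ ∑ cᵤ u` from `ℓ¹` over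
the positive part of the unit ball to `E` is onto, so the open mapping theorem bounds the norm of
a preimage; its positive and negative parts give the decomposition. -/
theorem exists_hasDecomposition [CompleteSpace E] [IsOrderedAddMonoid E] [IsOrderedModule ℝ E]
    [OrderClosedTopology E] (hgen : ∀ u : E, ∃ v w : E, 0 ≤ v ∧ 0 ≤ w ∧ u = v - w) :
    ∃ M, HasDecomposition E M := by
  classical
  set ι := {u : E // 0 ≤ u ∧ ‖u‖ ≤ 1}
  have hsn : ∀ c : lp (fun _ : ι => ℝ) 1, Summable fun i => ‖c i‖ := fun c => by
    simpa using (lp.memℓp c).summable (p := 1) (by simp)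
  have hle : ∀ (c : ι → ℝ) (i : ι), ‖c i • (i : E)‖ ≤ ‖c i‖ := fun c i => by
    rw [norm_smul]
    exact mul_le_of_le_one_right (norm_nonneg _) i.2.2
  have hs : ∀ c : lp (fun _ : ι => ℝ) 1, Summable fun i => c i • (i : E) := fun c =>
    Summable.of_norm_bounded (hsn c) (hle c)
  have hn : ∀ c : lp (fun _ : ι => ℝ) 1, ‖c‖ = ∑' i, ‖c i‖ := fun c => by
    simp [lp.norm_eq_tsum_rpow (p := 1) (by simp) c]
  let L : lp (fun _ : ι => ℝ) 1 →ₗ[ℝ] E :=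
    { toFun := fun c => ∑' i, c i • (i : E)
      map_add' := fun c d => by
        rw [← (hs c).tsum_add (hs d)]
        simp [add_smul]
      map_smul' := fun a c => by
        rw [RingHom.id_apply, ← (hs c).tsum_const_smul]
        simp [mul_smul] }
  let S : lp (fun _ : ι => ℝ) 1 →L[ℝ] E := L.mkContinuous 1 fun c => by
    rw [one_mul, hn]
    exact tsum_of_norm_bounded (hsn c).hasSum (hle c)
  have hpos : ∀ v : E, 0 ≤ v → ∃ c, S c = v := by
    intro v hv
    by_cases h0 : v = 0
    · exact ⟨0, by simp [h0]⟩
    have hnv : 0 < ‖v‖ := norm_pos_iff.2 h0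
    -- A positive `v` is `‖v‖` times an element of the index set.
    let i : ι := ⟨‖v‖⁻¹ • v, smul_nonneg (by positivity) hv, by
      rw [norm_smul, norm_inv, norm_norm, inv_mul_cancel₀ hnv.ne']⟩
    refine ⟨lp.single 1 i ‖v‖, ?_⟩
    change ∑' j, (lp.single 1 i ‖v‖ : lp (fun _ : ι => ℝ) 1) j • (j : E) = v
    rw [tsum_eq_single i]
    · simp [i, smul_smul, hnv.ne']
    · intro j hj
      simp [hj]
  have hsurj : Function.Surjective S := fun u => by
    obtain ⟨v, w, hv, hw, rfl⟩ := hgen u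
    obtain ⟨c, rfl⟩ := hpos v hv
    obtain ⟨d, rfl⟩ := hpos w hw
    exact ⟨c - d, map_sub _ _ _⟩
  obtain ⟨C, hC, h⟩ := S.exists_preimage_norm_le hsurj
  refine ⟨C, hC.le, fun u => ?_⟩
  obtain ⟨c, rfl, hc⟩ := h u
  have hp : Summable fun i => (c i)⁺ := Summable.of_norm_bounded (hsn c) fun i => by
    rw [Real.norm_of_nonneg (posPart_nonneg _)]
    exact sup_le (le_abs_self _) (abs_nonneg _)
  have hm : Summable fun i => (c i)⁻ := Summable.of_norm_bounded (hsn c) fun i => by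
    rw [Real.norm_of_nonneg (negPart_nonneg _)]
    exact sup_le (neg_le_abs _) (abs_nonneg _)
  have hp' : ∀ i : ι, ‖(c i)⁺ • (i : E)‖ ≤ (c i)⁺ := fun i =>
    (hle (fun i => (c i)⁺) i).trans_eq (Real.norm_of_nonneg (posPart_nonneg _))
  have hm' : ∀ i : ι, ‖(c i)⁻ • (i : E)‖ ≤ (c i)⁻ := fun i =>
    (hle (fun i => (c i)⁻) i).trans_eq (Real.norm_of_nonneg (negPart_nonneg _))
  refine ⟨∑' i, (c i)⁺ • (i : E), ∑' i, (c i)⁻ • (i : E),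
    tsum_nonneg fun i => smul_nonneg (posPart_nonneg _) i.2.1,
    tsum_nonneg fun i => smul_nonneg (negPart_nonneg _) i.2.1, ?_, ?_⟩
  · rw [← (Summable.of_norm_bounded hp hp').tsum_sub (Summable.of_norm_bounded hm hm')]
    change ∑' i, c i • (i : E) = _
    simp_rw [← sub_smul, posPart_sub_negPart]
  · refine (add_le_add (tsum_of_norm_bounded hp.hasSum hp')
      (tsum_of_norm_bounded hm.hasSum hm')).trans ?_
    rw [← hp.tsum_add hm]
    simp_rw [posPart_add_negPart]
    exact (hn c).symm.le.trans hc

/-- On an abstract state space the norm of the cone extends to a bounded linear functional. -/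
theorem IsAbstractStateSpace.exists_functional (hE : IsAbstractStateSpace E)
    [IsOrderedAddMonoid E] [IsOrderedModule ℝ E] {M : ℝ} (hM : HasDecomposition E M) :
    ∃ ψ : E →L[ℝ] ℝ, ∀ u, 0 ≤ u → ψ u = ‖u‖ := by
  choose p q hp hq hpq hn using hM.2
  have key : ∀ u v w : E, 0 ≤ v → 0 ≤ w → u = v - w → ‖p u‖ - ‖q u‖ = ‖v‖ - ‖w‖ := by
    intro u v w hv hw h
    have h1 : p u + w = v + q u := by
      have := (hpq u).symm.trans h
      rw [sub_eq_sub_iff_add_eq_add] at this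
      rw [this]
    have h2 := congrArg norm h1
    rw [hE.norm_add _ _ (hp u) hw, hE.norm_add _ _ hv (hq u)] at h2
    linarith
  let L : E →ₗ[ℝ] ℝ :=
    { toFun := fun u => ‖p u‖ - ‖q u‖
      map_add' := fun u v => by
        rw [key (u + v) (p u + p v) (q u + q v) (add_nonneg (hp u) (hp v))
          (add_nonneg (hq u) (hq v)), hE.norm_add _ _ (hp u) (hp v),
          hE.norm_add _ _ (hq u) (hq v)]
        · ring
        · conv_lhs => rw [hpq u, hpq v]
          abel
      map_smul' := fun a u => by
        rw [RingHom.id_apply, smul_eq_mul]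
        rcases le_total 0 a with ha | ha
        · rw [key (a • u) (a • p u) (a • q u) (smul_nonneg ha (hp u)) (smul_nonneg ha (hq u)),
            norm_smul, norm_smul, Real.norm_of_nonneg ha]
          · ring
          · conv_lhs => rw [hpq u, smul_sub]
        · have ha' : 0 ≤ -a := neg_nonneg.2 ha
          rw [key (a • u) ((-a) • q u) ((-a) • p u) (smul_nonneg ha' (hq u))
            (smul_nonneg ha' (hp u)), norm_smul, norm_smul, Real.norm_of_nonneg ha']
          · ring
          · conv_lhs => rw [hpq u, smul_sub]
            rw [neg_smul, neg_smul]
            abel }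
  refine ⟨L.mkContinuous M fun u => ?_, fun u hu => ?_⟩
  · refine le_trans ?_ (hn u)
    change |‖p u‖ - ‖q u‖| ≤ _
    rw [abs_le]
    constructor <;> linarith [norm_nonneg (p u), norm_nonneg (q u)]
  · change ‖p u‖ - ‖q u‖ = ‖u‖
    rw [key u u 0 hu le_rfl (sub_zero u).symm]
    simp

/-- The norm of the cone of `L¹` extends to a unique bounded linear functional: integrate and apply
the functional of `E`; uniqueness holds since differences of positive elements are dense. -/
theorem IsAbstractStateSpace.existsUnique_lifted_functional (hE : IsAbstractStateSpace E)
    [CompleteSpace E] [IsOrderedAddMonoid E] [IsOrderedModule ℝ E] {M : ℝ}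
    (hM : HasDecomposition E M) :
    ∃! Ψ : LiftedSpace E →L[ℝ] ℝ, ∀ f ∈ liftedCone E, Ψ f = ‖f‖ := by
  obtain ⟨ψ, hψ⟩ := hE.exists_functional hM
  have hΨ' : ∀ f ∈ liftedCone E, (ψ.comp L1.integralCLM) f = ‖f‖ := fun f hf => by
    change ψ (L1.integralCLM f) = ‖f‖
    rw [← L1.integral_eq, L1.integral_eq_integral, L1.norm_eq_integral_norm,
      ← ψ.integral_comp_comm (L1.integrable_coeFn f)]
    refine integral_congr_ae ?_
    filter_upwards [hf] with s hs using hψ _ hs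
  refine ⟨ψ.comp L1.integralCLM, hΨ', fun Ψ hΨ => ?_⟩
  ext f
  refine Lp.induction (by simp) (fun f => Ψ f = (ψ.comp L1.integralCLM) f) ?_ ?_ ?_ f
  · intro c s hs hμ
    have hpos : ∀ v : E, 0 ≤ v →
        (indicatorConstLp 1 hs hμ.ne v : LiftedSpace E) ∈ liftedCone E := by
      intro v hv
      filter_upwards [indicatorConstLp_coeFn (p := 1) (hs := hs) (hμs := hμ.ne) (c := v)]
        with x hx
      rw [hx]
      exact indicator_nonneg (fun _ _ => hv) _
    obtain ⟨v, w, hv, hw, rfl, -⟩ := hM.2 c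
    rw [Lp.simpleFunc.coe_indicatorConst, ← indicatorConstLp_sub, map_sub, map_sub,
      hΨ _ (hpos v hv), hΨ _ (hpos w hw), hΨ' _ (hpos v hv), hΨ' _ (hpos w hw)]
  · intro f g hf hg _ h1 h2
    rw [map_add, map_add, h1, h2]
  · exact isClosed_eq Ψ.continuous (ContinuousLinearMap.continuous _)

end Cone

/-! ### Values of unbounded operators -/

section UnboundedValue

variable {F : Type*} [AddCommGroup F] [Module ℝ F] (A : F →ₗ.[ℝ] F)

theorem LinearPMap.val_of_mem {u : F} (h : u ∈ A.domain) : A.val u = A ⟨u, h⟩ := by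
  classical
  exact dif_pos h

theorem LinearPMap.val_add {u v : F} (hu : u ∈ A.domain) (hv : v ∈ A.domain) :
    A.val (u + v) = A.val u + A.val v := by
  rw [A.val_of_mem hu, A.val_of_mem hv, A.val_of_mem (add_mem hu hv), ← A.map_add]
  rfl

theorem LinearPMap.val_smul (c : ℝ) {u : F} (hu : u ∈ A.domain) :
    A.val (c • u) = c • A.val u := by
  rw [A.val_of_mem hu, A.val_of_mem (A.domain.smul_mem c hu), ← A.map_smul]
  rfl

theorem LinearPMap.val_sub {u v : F} (hu : u ∈ A.domain) (hv : v ∈ A.domain) :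
    A.val (u - v) = A.val u - A.val v := by
  rw [A.val_of_mem hu, A.val_of_mem hv, A.val_of_mem (sub_mem hu hv), ← A.map_sub]
  rfl

end UnboundedValue

/-! ### Estimates for `B(t)U(t,s)u` and substochastic families -/

/-- An additive map that is contractive on the cone is bounded by the decomposition constant. -/
theorem HasDecomposition.norm_map_le {E : Type*} [NormedAddCommGroup E] [PartialOrder E] {M : ℝ}
    (hM : HasDecomposition E M) {F : Type*}
    [SeminormedAddCommGroup F] {Φ : E → F}
    (hsub : ∀ u v, Φ (u - v) = Φ u - Φ v) (hΦ : ∀ u, 0 ≤ u → ‖Φ u‖ ≤ ‖u‖) (u : E) :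
    ‖Φ u‖ ≤ M * ‖u‖ := by
  obtain ⟨v, w, hv, hw, rfl, h⟩ := hM.2 u
  rw [hsub]
  exact (norm_sub_le _ _).trans ((add_le_add (hΦ v hv) (hΦ w hw)).trans h)

section PerturbedFamily

variable {E : Type*} [NormedAddCommGroup E] [NormedSpace ℝ E] [PartialOrder E] {M : ℝ}
  {U : ℝ → ℝ → E →L[ℝ] E} {B : ℝ → E →ₗ.[ℝ] E}

namespace IsPerturbedFamily

theorem norm_le_mul (h : IsPerturbedFamily U B) (hM : HasDecomposition E M) {t s : ℝ} (hs : 0 ≤ s)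
    (hst : s ≤ t) (u : E) : ‖U t s u‖ ≤ M * ‖u‖ :=
  hM.norm_map_le (map_sub _) (h.norm_le t s hs hst) u

theorem val_nonneg (h : IsPerturbedFamily U B) {t : ℝ} (ht : 0 ≤ t) {u : E} (hu : 0 ≤ u) :
    0 ≤ (B t).val u := by
  by_cases hd : u ∈ (B t).domain
  · rw [LinearPMap.val_of_mem _ hd]
    exact h.B_nonneg t ht ⟨u, hd⟩ hu
  · -- Outside the domain the value is `0`.
    rw [LinearPMap.val, dif_neg hd]

theorem val_sub (h : IsPerturbedFamily U B) {s : ℝ} (hs : 0 ≤ s) (u v : E) :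
    ∀ᵐ t ∂volume.restrict (Ici s),
      (B t).val (U t s (u - v)) = (B t).val (U t s u) - (B t).val (U t s v) := by
  filter_upwards [h.mem_domain s hs u, h.mem_domain s hs v] with t hu hv
  rw [map_sub, LinearPMap.val_sub _ hu hv]

theorem val_smul (h : IsPerturbedFamily U B) {s : ℝ} (hs : 0 ≤ s) (c : ℝ) (u : E) :
    ∀ᵐ t ∂volume.restrict (Ici s),
      (B t).val (U t s (c • u)) = c • (B t).val (U t s u) := by
  filter_upwards [h.mem_domain s hs u] with t hu
  rw [map_smul, LinearPMap.val_smul _ _ hu]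

theorem lintegral_Ici_le_of_nonneg (h : IsPerturbedFamily U B) {s : ℝ} (hs : 0 ≤ s) {u : E}
    (hu : 0 ≤ u) : ∫⁻ τ in Ici s, ‖(B τ).val (U τ s u)‖ₑ ≤ ENNReal.ofReal ‖u‖ := by
  have hU : Ici s = ⋃ n : ℕ, Icc s (s + n) := by
    ext x
    simp only [mem_Ici, mem_iUnion, mem_Icc]
    refine ⟨fun hx => ?_, fun ⟨n, hn⟩ => hn.1⟩
    obtain ⟨n, hn⟩ := exists_nat_ge (x - s)
    exact ⟨n, hx, by linarith⟩
  rw [hU, setLIntegral_iUnion_of_directed]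
  · refine iSup_le fun n => (h.lintegral_le (s + n) s hs (by simp) u hu).trans ?_
    exact ENNReal.ofReal_le_ofReal (sub_le_self _ (norm_nonneg _))
  · refine directed_of_isDirected_le fun m n hmn => Icc_subset_Icc_right ?_
    have : (m : ℝ) ≤ n := by exact_mod_cast hmn
    linarith

theorem lintegral_Ici_le (h : IsPerturbedFamily U B) (hM : HasDecomposition E M) {s : ℝ}
    (hs : 0 ≤ s) (u : E) :
    ∫⁻ τ in Ici s, ‖(B τ).val (U τ s u)‖ₑ ≤ ENNReal.ofReal (M * ‖u‖) := by
  obtain ⟨v, w, hv, hw, rfl, hn⟩ := hM.2 u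
  calc ∫⁻ τ in Ici s, ‖(B τ).val (U τ s (v - w))‖ₑ
      ≤ ∫⁻ τ in Ici s, (‖(B τ).val (U τ s v)‖ₑ + ‖(B τ).val (U τ s w)‖ₑ) := by
        refine lintegral_mono_ae ?_
        filter_upwards [h.val_sub hs v w] with τ hτ
        rw [hτ]
        exact enorm_sub_le
    _ = (∫⁻ τ in Ici s, ‖(B τ).val (U τ s v)‖ₑ) + ∫⁻ τ in Ici s, ‖(B τ).val (U τ s w)‖ₑ :=
        lintegral_add_left' (h.measurable s hs v).enorm _
    _ ≤ ENNReal.ofReal ‖v‖ + ENNReal.ofReal ‖w‖ :=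
        add_le_add (h.lintegral_Ici_le_of_nonneg hs hv) (h.lintegral_Ici_le_of_nonneg hs hw)
    _ = ENNReal.ofReal (‖v‖ + ‖w‖) := (ENNReal.ofReal_add (norm_nonneg _) (norm_nonneg _)).symm
    _ ≤ _ := ENNReal.ofReal_le_ofReal hn

theorem integrableOn_Ici (h : IsPerturbedFamily U B) (hM : HasDecomposition E M) {s : ℝ}
    (hs : 0 ≤ s) (u : E) : IntegrableOn (fun τ => (B τ).val (U τ s u)) (Ici s) :=
  ⟨h.measurable s hs u, (h.lintegral_Ici_le hM hs u).trans_lt ENNReal.ofReal_lt_top⟩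

theorem integral_norm_le (h : IsPerturbedFamily U B) {t s : ℝ} (hs : 0 ≤ s) (hst : s ≤ t)
    {u : E} (hu : 0 ≤ u) : ∫ τ in s..t, ‖(B τ).val (U τ s u)‖ ≤ ‖u‖ - ‖U t s u‖ := by
  rw [intervalIntegral.integral_of_le hst, ← integral_Icc_eq_integral_Ioc,
    integral_norm_eq_lintegral_enorm ((h.measurable s hs u).mono_set Icc_subset_Ici_self)]
  exact ENNReal.toReal_le_of_le_ofReal (sub_nonneg.2 (h.norm_le t s hs hst u hu))
    (h.lintegral_le t s hs hst u hu)

end IsPerturbedFamily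

/-- A strongly continuous family, indexed by `0 ≤ s ≤ t`, of positive linear operators that are
contractive on the cone. -/
structure IsSubstochasticFamily (W : ℝ → ℝ → E → E) : Prop where
  add : ∀ t s : ℝ, 0 ≤ s → s ≤ t → ∀ u v, W t s (u + v) = W t s u + W t s v
  smul : ∀ t s : ℝ, 0 ≤ s → s ≤ t → ∀ (c : ℝ) u, W t s (c • u) = c • W t s u
  nonneg : ∀ t s : ℝ, 0 ≤ s → s ≤ t → ∀ u, 0 ≤ u → 0 ≤ W t s u
  norm_le : ∀ t s : ℝ, 0 ≤ s → s ≤ t → ∀ u, 0 ≤ u → ‖W t s u‖ ≤ ‖u‖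
  continuousOn : ∀ u, ContinuousOn (fun p : ℝ × ℝ => W p.1 p.2 u) evolutionIndex

theorem IsPerturbedFamily.isSubstochasticFamily (h : IsPerturbedFamily U B) :
    IsSubstochasticFamily fun t s u => U t s u :=
  ⟨fun _ _ _ _ _ _ => map_add _ _ _, fun _ _ _ _ _ _ => map_smul _ _ _, h.nonneg, h.norm_le,
    h.evolution.continuousOn⟩

/-- `W` preserves strong measurability: `x ↦ W(a(x), b(x)) g(x)` is strongly measurable whenever
`a`, `b` and `g` are measurable and `0 ≤ b ≤ a`. -/
def IsMeasurableFamily {E : Type*} [NormedAddCommGroup E] (W : ℝ → ℝ → E → E) : Prop :=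
  ∀ (α : Type) [MeasurableSpace α] (μ : Measure α) (a b : α → ℝ) (g : α → E),
    AEMeasurable a μ → AEMeasurable b μ → (∀ᵐ x ∂μ, 0 ≤ b x ∧ b x ≤ a x) →
    AEStronglyMeasurable g μ → AEStronglyMeasurable (fun x => W (a x) (b x) (g x)) μ

namespace IsSubstochasticFamily

variable {W : ℝ → ℝ → E → E}

theorem sub (hW : IsSubstochasticFamily W) {t s : ℝ} (hs : 0 ≤ s) (hst : s ≤ t) (u v : E) :
    W t s (u - v) = W t s u - W t s v := by
  rw [sub_eq_add_neg, ← neg_one_smul ℝ v, hW.add t s hs hst, hW.smul t s hs hst, neg_one_smul,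
    ← sub_eq_add_neg]

theorem norm_le_mul (hW : IsSubstochasticFamily W) (hM : HasDecomposition E M) {t s : ℝ}
    (hs : 0 ≤ s) (hst : s ≤ t) (u : E) : ‖W t s u‖ ≤ M * ‖u‖ :=
  hM.norm_map_le (hW.sub hs hst) (hW.norm_le t s hs hst) u

theorem exists_clm (hW : IsSubstochasticFamily W) (hM : HasDecomposition E M) {t s : ℝ}
    (hs : 0 ≤ s) (hst : s ≤ t) : ∃ L : E →L[ℝ] E, ∀ u, L u = W t s u :=
  ⟨LinearMap.mkContinuous ⟨⟨W t s, hW.add t s hs hst⟩, hW.smul t s hs hst⟩ M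
    (hW.norm_le_mul hM hs hst), fun _ => rfl⟩

/-- Composing with the retraction `(t, s) ↦ (max t s⁺, s⁺)` of the plane onto `{0 ≤ s ≤ t}` makes
`((t, s), u) ↦ W(t, s)u` continuous everywhere. -/
theorem isMeasurableFamily (hW : IsSubstochasticFamily W) (hM : HasDecomposition E M) :
    IsMeasurableFamily W := by
  intro α _ μ a b g ha hb hab hg
  let π : ℝ × ℝ → ℝ × ℝ := fun p => (max p.1 (max p.2 0), max p.2 0)
  have hπ : Continuous π := by fun_prop
  have hπm : ∀ p, 0 ≤ (π p).2 ∧ (π p).2 ≤ (π p).1 := fun p =>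
    ⟨le_max_right _ _, le_max_right _ _⟩
  have hc : Continuous fun q : (ℝ × ℝ) × E => W (π q.1).1 (π q.1).2 q.2 := by
    have hc1 : ∀ u, Continuous fun p : ℝ × ℝ => W (π p).1 (π p).2 u := fun u =>
      (hW.continuousOn u).comp_continuous hπ hπm
    rw [continuous_iff_continuousAt]
    rintro ⟨p₀, u₀⟩
    have h1 : Tendsto (fun q : (ℝ × ℝ) × E => W (π q.1).1 (π q.1).2 (q.2 - u₀)) (𝓝 (p₀, u₀))
        (𝓝 0) := by
      refine squeeze_zero_norm (fun q => hW.norm_le_mul hM (hπm q.1).1 (hπm q.1).2 _) ?_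
      have : Continuous fun q : (ℝ × ℝ) × E => M * ‖q.2 - u₀‖ := by fun_prop
      simpa using this.tendsto (p₀, u₀)
    have h2 := ((hc1 u₀).comp continuous_fst).tendsto (p₀, u₀)
    have h3 := h1.add h2
    rw [zero_add] at h3
    refine h3.congr fun q => ?_
    simp only [Function.comp_apply]
    rw [← hW.add _ _ (hπm q.1).1 (hπm q.1).2, sub_add_cancel]
  have hm := hc.comp_aestronglyMeasurable
    ((ha.aestronglyMeasurable.prodMk hb.aestronglyMeasurable).prodMk hg)
  refine hm.congr ?_
  filter_upwards [hab] with x hx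
  simp only [π, max_eq_left hx.1, max_eq_left hx.2]

theorem integrableOn_comp (hW : IsSubstochasticFamily W) (h : IsPerturbedFamily U B)
    (hM : HasDecomposition E M) {t s : ℝ} (hs : 0 ≤ s) (u : E) :
    IntegrableOn (fun r => W t r ((B r).val (U r s u))) (Icc s t) := by
  refine Integrable.mono'
    (((h.integrableOn_Ici hM hs u).mono_set Icc_subset_Ici_self).norm.const_mul M) ?_ ?_
  · refine hW.isMeasurableFamily hM ℝ _ (fun _ => t) id _ aemeasurable_const aemeasurable_id ?_
      ((h.measurable s hs u).mono_set Icc_subset_Ici_self)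
    filter_upwards [ae_restrict_mem measurableSet_Icc] with r hr using ⟨hs.trans hr.1, hr.2⟩
  · filter_upwards [ae_restrict_mem measurableSet_Icc] with r hr
    exact hW.norm_le_mul hM (hs.trans hr.1) hr.2 _

theorem intervalIntegrable_comp (hW : IsSubstochasticFamily W) (h : IsPerturbedFamily U B)
    (hM : HasDecomposition E M) {t s a b : ℝ} (hs : 0 ≤ s) (ha : s ≤ a) (hab : a ≤ b) (hb : b ≤ t)
    (u : E) : IntervalIntegrable (fun r => W t r ((B r).val (U r s u))) volume a b := by
  rw [intervalIntegrable_iff_integrableOn_Icc_of_le hab]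
  exact (hW.integrableOn_comp h hM hs u).mono_set (Icc_subset_Icc ha hb)

end IsSubstochasticFamily

end PerturbedFamily

/-! ### One step of the Dyson–Phillips iteration -/

section DysonPhillips

variable {E : Type*} [NormedAddCommGroup E] [NormedSpace ℝ E] [PartialOrder E] {M : ℝ}
  {U : ℝ → ℝ → E →L[ℝ] E} {B : ℝ → E →ₗ.[ℝ] E}

/-- The operation `W ↦ ∫ₛᵗ W(t,r) B(r) U(r,s) u dr` that leads from one Dyson–Phillips iterate to
the next. -/
noncomputable def dysonStep (U : ℝ → ℝ → E →L[ℝ] E) (B : ℝ → E →ₗ.[ℝ] E) (W : ℝ → ℝ → E → E)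
    (t s : ℝ) (u : E) : E :=
  ∫ r in s..t, W t r ((B r).val (U r s u))

namespace IsSubstochasticFamily

variable {W : ℝ → ℝ → E → E}

theorem dysonStep_sub (hW : IsSubstochasticFamily W) (h : IsPerturbedFamily U B)
    (hM : HasDecomposition E M) {t s : ℝ} (hs : 0 ≤ s) (hst : s ≤ t) (u v : E) :
    dysonStep U B W t s (u - v) = dysonStep U B W t s u - dysonStep U B W t s v := by
  rw [dysonStep, dysonStep, dysonStep, ← intervalIntegral.integral_sub
    (hW.intervalIntegrable_comp h hM hs le_rfl hst le_rfl u)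
    (hW.intervalIntegrable_comp h hM hs le_rfl hst le_rfl v)]
  refine intervalIntegral.integral_congr_ae ?_
  filter_upwards [(ae_restrict_iff' measurableSet_Ici).1 (h.val_sub hs u v)] with r hr hrm
  rw [uIoc_of_le hst] at hrm
  rw [hr hrm.1.le, hW.sub (hs.trans hrm.1.le) hrm.2]

theorem dysonStep_smul (hW : IsSubstochasticFamily W) (h : IsPerturbedFamily U B)
    {t s : ℝ} (hs : 0 ≤ s) (hst : s ≤ t) (c : ℝ) (u : E) :
    dysonStep U B W t s (c • u) = c • dysonStep U B W t s u := by
  rw [dysonStep, dysonStep, ← intervalIntegral.integral_smul]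
  refine intervalIntegral.integral_congr_ae ?_
  filter_upwards [(ae_restrict_iff' measurableSet_Ici).1 (h.val_smul hs c u)] with r hr hrm
  rw [uIoc_of_le hst] at hrm
  rw [hr hrm.1.le, hW.smul _ _ (hs.trans hrm.1.le) hrm.2]

/-- The integral of `‖W(t,r) B(r) U(r,s) u‖` is controlled by the loss of mass of `U(·,s)u`. -/
theorem norm_integral_comp_le (hW : IsSubstochasticFamily W) (h : IsPerturbedFamily U B)
    (hM : HasDecomposition E M) {t r s : ℝ} (hs : 0 ≤ s) (hsr : s ≤ r) (hrt : r ≤ t) {u : E}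
    (hu : 0 ≤ u) :
    ‖∫ ρ in s..r, W t ρ ((B ρ).val (U ρ s u))‖ ≤ ‖u‖ - ‖U r s u‖ := by
  refine (intervalIntegral.norm_integral_le_integral_norm hsr).trans
    (le_trans ?_ (h.integral_norm_le hs hsr hu))
  refine intervalIntegral.integral_mono_on hsr
    (hW.intervalIntegrable_comp h hM hs le_rfl hsr hrt u).norm ?_ fun ρ hρ =>
      hW.norm_le t ρ (hs.trans hρ.1) (hρ.2.trans hrt) _
        (h.val_nonneg (hs.trans hρ.1) (h.nonneg ρ s hs hρ.1 u hu))
  rw [intervalIntegrable_iff_integrableOn_Icc_of_le hsr]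
  exact ((h.integrableOn_Ici hM hs u).mono_set Icc_subset_Ici_self).norm

/-- Splitting the integral at `r`; the part after `r` is a step applied to `U(r,s)u`, by the
evolution law of `U`. -/
theorem dysonStep_split (hW : IsSubstochasticFamily W) (h : IsPerturbedFamily U B)
    (hM : HasDecomposition E M) {t r s : ℝ} (hs : 0 ≤ s) (hsr : s ≤ r) (hrt : r ≤ t) (u : E) :
    dysonStep U B W t s u =
      (∫ ρ in s..r, W t ρ ((B ρ).val (U ρ s u))) + dysonStep U B W t r (U r s u) := by
  rw [dysonStep, dysonStep, ← intervalIntegral.integral_add_adjacent_intervals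
    (hW.intervalIntegrable_comp h hM hs le_rfl hsr hrt u)
    (hW.intervalIntegrable_comp h hM hs hsr hrt le_rfl u)]
  congr 1
  refine intervalIntegral.integral_congr fun ρ hρ => ?_
  rw [uIcc_of_le hrt] at hρ
  simp only [h.evolution.comp ρ r s hs hsr hρ.1, ContinuousLinearMap.comp_apply]

theorem dysonStep_norm_le_mul (hW : IsSubstochasticFamily W) (h : IsPerturbedFamily U B)
    (hM : HasDecomposition E M) {t s : ℝ} (hs : 0 ≤ s) (hst : s ≤ t) (u : E) :
    ‖dysonStep U B W t s u‖ ≤ M * ‖u‖ :=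
  hM.norm_map_le (hW.dysonStep_sub h hM hs hst)
    (fun _ hv => (hW.norm_integral_comp_le h hM hs hst le_rfl hv).trans
      (sub_le_self _ (norm_nonneg _))) u

/-- Equicontinuity in the second variable. -/
theorem norm_dysonStep_sub_le (hW : IsSubstochasticFamily W) (h : IsPerturbedFamily U B)
    (hM : HasDecomposition E M) {t r s : ℝ} (hs : 0 ≤ s) (hsr : s ≤ r) (hrt : r ≤ t) {u : E}
    (hu : 0 ≤ u) :
    ‖dysonStep U B W t s u - dysonStep U B W t r u‖ ≤ (1 + M) * ‖U r s u - u‖ := by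
  have h1 := hW.norm_integral_comp_le h hM hs hsr hrt hu
  have h2 := hW.dysonStep_norm_le_mul h hM (hs.trans hsr) hrt (U r s u - u)
  rw [hW.dysonStep_sub h hM (hs.trans hsr) hrt] at h2
  have h3 : ‖u‖ - ‖U r s u‖ ≤ ‖U r s u - u‖ := by
    rw [norm_sub_rev]
    exact norm_sub_norm_le _ _
  rw [hW.dysonStep_split h hM hs hsr hrt u, add_sub_assoc]
  refine (norm_add_le _ _).trans ?_
  linarith

/-- Continuity in the first variable, by dominated convergence. -/
theorem continuousOn_dysonStep_left (hW : IsSubstochasticFamily W) (h : IsPerturbedFamily U B)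
    (hM : HasDecomposition E M) {s : ℝ} (hs : 0 ≤ s) (u : E) :
    ContinuousOn (fun t => dysonStep U B W t s u) (Ici s) := by
  intro t₀ ht₀
  have ht₀ : s ≤ t₀ := ht₀
  -- For `t ≤ R` the integral is taken over the fixed interval `(s, R]` with the integrand cut off
  -- at `t`; the cut-off integrands converge at every `r ≠ t₀`.
  set R := t₀ + 1
  have hev : ∀ᶠ t in 𝓝[Ici s] t₀, s ≤ t ∧ t ≤ R := by
    filter_upwards [self_mem_nhdsWithin,
      mem_nhdsWithin_of_mem_nhds (Iio_mem_nhds (lt_add_one t₀))] with t h1 h2 using ⟨h1, h2.le⟩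
  have heq : ∀ t, s ≤ t → t ≤ R → dysonStep U B W t s u =
      ∫ r in Ioc s R, (Ioc s t).indicator (fun r => W t r ((B r).val (U r s u))) r := by
    intro t h1 h2
    rw [dysonStep, intervalIntegral.integral_of_le h1, setIntegral_indicator measurableSet_Ioc,
      Ioc_inter_Ioc, max_self, min_eq_right h2]
  rw [ContinuousWithinAt, heq t₀ ht₀ (by simp [R])]
  refine Tendsto.congr' (f₁ := fun t => ∫ r in Ioc s R,
    (Ioc s t).indicator (fun r => W t r ((B r).val (U r s u))) r) ?_ ?_
  · filter_upwards [hev] with t ht using (heq t ht.1 ht.2).symm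
  · have hInt := ((h.integrableOn_Ici hM hs u).mono_set
      (Ioc_subset_Icc_self.trans (Icc_subset_Ici_self : Icc s R ⊆ Ici s))).norm.const_mul M
    refine tendsto_integral_filter_of_dominated_convergence
      (fun r => M * ‖(B r).val (U r s u)‖) ?_ ?_ hInt ?_
    · filter_upwards [hev] with t ht
      rw [aestronglyMeasurable_indicator_iff measurableSet_Ioc,
        Measure.restrict_restrict measurableSet_Ioc]
      refine ((hW.integrableOn_comp h hM hs u).mono_set
        (inter_subset_left.trans Ioc_subset_Icc_self)).aestronglyMeasurable
    · filter_upwards [hev] with t ht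
      refine Eventually.of_forall fun r => ?_
      by_cases hr : r ∈ Ioc s t
      · rw [indicator_of_mem hr]
        exact hW.norm_le_mul hM (hs.trans hr.1.le) hr.2 _
      · rw [indicator_of_notMem hr, norm_zero]
        exact mul_nonneg hM.1 (norm_nonneg _)
    · filter_upwards [ae_restrict_mem measurableSet_Ioc,
        ae_restrict_of_ae (measure_eq_zero_iff_ae_notMem.1 (measure_singleton t₀ (μ := volume)))]
        with r hr hrt
      rcases lt_or_gt_of_ne (fun hh : r = t₀ => hrt hh) with hlt | hgt
      · rw [indicator_of_mem (show r ∈ Ioc s t₀ from ⟨hr.1, hlt.le⟩)]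
        have hev' : ∀ᶠ t in 𝓝[Ici s] t₀, r < t :=
          mem_nhdsWithin_of_mem_nhds (Ioi_mem_nhds hlt)
        have hc := (hW.continuousOn ((B r).val (U r s u))) (t₀, r) ⟨hs.trans hr.1.le, hlt.le⟩
        have ht : Tendsto (fun t : ℝ => (t, r)) (𝓝[Ici s] t₀) (𝓝[evolutionIndex] (t₀, r)) := by
          refine tendsto_nhdsWithin_iff.2 ⟨?_, ?_⟩
          · exact ((continuous_id.prodMk continuous_const).tendsto t₀).mono_left
              nhdsWithin_le_nhds
          · filter_upwards [hev'] with t ht using ⟨hs.trans hr.1.le, ht.le⟩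
        refine (hc.tendsto.comp ht).congr' ?_
        filter_upwards [hev'] with t ht
        rw [indicator_of_mem (show r ∈ Ioc s t from ⟨hr.1, ht.le⟩)]
        rfl
      · rw [indicator_of_notMem (fun hh => absurd hh.2 (not_le.2 hgt))]
        refine tendsto_const_nhds.congr' ?_
        filter_upwards [mem_nhdsWithin_of_mem_nhds (Iio_mem_nhds hgt)] with t ht
        rw [indicator_of_notMem (fun hh => absurd hh.2 (not_le.2 ht))]

/-- Joint continuity: at the diagonal the loss of mass of `U` controls the size; away from it the
estimate is uniform in the first variable. -/
theorem continuousOn_dysonStep_of_nonneg (hW : IsSubstochasticFamily W)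
    (h : IsPerturbedFamily U B) (hM : HasDecomposition E M) {u : E} (hu : 0 ≤ u) :
    ContinuousOn (fun p : ℝ × ℝ => dysonStep U B W p.1 p.2 u) evolutionIndex := by
  rintro ⟨t₀, s₀⟩ ⟨hs₀, hst₀⟩
  simp only at hs₀ hst₀
  rcases hst₀.eq_or_lt with rfl | hlt
  · have h0 : dysonStep U B W s₀ s₀ u = 0 := intervalIntegral.integral_same
    rw [ContinuousWithinAt, h0]
    have hc := (h.evolution.continuousOn u (s₀, s₀) ⟨hs₀, le_rfl⟩).norm
    have hc' := (tendsto_const_nhds (x := ‖u‖)).sub hc.tendsto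
    simp only [h.evolution.refl s₀ hs₀, ContinuousLinearMap.id_apply, sub_self] at hc'
    refine squeeze_zero_norm' ?_ hc'
    filter_upwards [self_mem_nhdsWithin] with p hp
    exact hW.norm_integral_comp_le h hM hp.1 hp.2 le_rfl hu
  · have hev : ∀ᶠ p in 𝓝[evolutionIndex] (t₀, s₀), 0 ≤ p.2 ∧ p.2 ≤ p.1 ∧ s₀ < p.1 := by
      have h1 : ∀ᶠ p : ℝ × ℝ in 𝓝 (t₀, s₀), s₀ < p.1 :=
        continuous_fst.tendsto (t₀, s₀) (Ioi_mem_nhds hlt)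
      filter_upwards [self_mem_nhdsWithin, mem_nhdsWithin_of_mem_nhds h1] with p hp hp'
        using ⟨hp.1, hp.2, hp'⟩
    have hleft : Tendsto (fun p : ℝ × ℝ => dysonStep U B W p.1 s₀ u)
        (𝓝[evolutionIndex] (t₀, s₀)) (𝓝 (dysonStep U B W t₀ s₀ u)) := by
      refine ((hW.continuousOn_dysonStep_left h hM hs₀ u) t₀ hlt.le).tendsto.comp
        (tendsto_nhdsWithin_iff.2 ⟨(continuous_fst.tendsto _).mono_left nhdsWithin_le_nhds, ?_⟩)
      filter_upwards [hev] with p hp using hp.2.2.le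
    have hU : Tendsto (fun p : ℝ × ℝ => (1 + M) * ‖U (max p.2 s₀) (min p.2 s₀) u - u‖)
        (𝓝[evolutionIndex] (t₀, s₀)) (𝓝 0) := by
      have hc := h.evolution.continuousOn u (s₀, s₀) ⟨hs₀, le_rfl⟩
      have hπ : Tendsto (fun p : ℝ × ℝ => (max p.2 s₀, min p.2 s₀))
          (𝓝[evolutionIndex] (t₀, s₀)) (𝓝[evolutionIndex] (s₀, s₀)) := by
        refine tendsto_nhdsWithin_iff.2 ⟨?_, ?_⟩
        · have : Continuous fun p : ℝ × ℝ => (max p.2 s₀, min p.2 s₀) := by fun_prop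
          simpa using (this.tendsto (t₀, s₀)).mono_left nhdsWithin_le_nhds
        · filter_upwards [hev] with p hp
          exact ⟨le_min hp.1 hs₀, min_le_max⟩
      have := (((hc.tendsto.comp hπ).sub_const u).norm).const_mul (1 + M)
      simpa [h.evolution.refl s₀ hs₀] using this
    rw [ContinuousWithinAt, tendsto_iff_norm_sub_tendsto_zero]
    have hsum := hU.add (tendsto_iff_norm_sub_tendsto_zero.1 hleft)
    rw [add_zero] at hsum
    refine squeeze_zero' (Eventually.of_forall fun _ => norm_nonneg _) ?_ hsum
    filter_upwards [hev] with p hp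
    have htri := norm_add_le (dysonStep U B W p.1 p.2 u - dysonStep U B W p.1 s₀ u)
      (dysonStep U B W p.1 s₀ u - dysonStep U B W t₀ s₀ u)
    rw [sub_add_sub_cancel] at htri
    refine htri.trans (add_le_add ?_ le_rfl)
    rcases le_total p.2 s₀ with hle | hle
    · rw [max_eq_right hle, min_eq_left hle]
      exact hW.norm_dysonStep_sub_le h hM hp.1 hle hp.2.2.le hu
    · rw [max_eq_left hle, min_eq_right hle, norm_sub_rev]
      exact hW.norm_dysonStep_sub_le h hM hs₀ hle hp.2.1 hu

variable [IsOrderedAddMonoid E] [IsOrderedModule ℝ E] [OrderClosedTopology E]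

theorem dysonStep_isSubstochasticFamily (hW : IsSubstochasticFamily W) (h : IsPerturbedFamily U B)
    (hM : HasDecomposition E M) : IsSubstochasticFamily (dysonStep U B W) where
  add t s hs hst u v := by
    have h1 := hW.dysonStep_sub h hM hs hst (u + v) v
    rw [add_sub_cancel_right] at h1
    rw [h1, sub_add_cancel]
  smul t s hs hst c u := hW.dysonStep_smul h hs hst c u
  nonneg t s hs hst u hu := by
    rw [dysonStep, intervalIntegral.integral_of_le hst]
    refine integral_nonneg_of_ae ?_
    filter_upwards [ae_restrict_mem measurableSet_Ioc] with r hr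
    exact hW.nonneg t r (hs.trans hr.1.le) hr.2 _
      (h.val_nonneg (hs.trans hr.1.le) (h.nonneg r s hs hr.1.le u hu))
  norm_le t s hs hst u hu := (hW.norm_integral_comp_le h hM hs hst le_rfl hu).trans
    (sub_le_self _ (norm_nonneg _))
  continuousOn u := by
    obtain ⟨v, w, hv, hw, rfl, -⟩ := hM.2 u
    refine ((hW.continuousOn_dysonStep_of_nonneg h hM hv).sub
      (hW.continuousOn_dysonStep_of_nonneg h hM hw)).congr fun p hp => ?_
    exact hW.dysonStep_sub h hM hp.1 hp.2 v w

end IsSubstochasticFamily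

end DysonPhillips

/-! ### The perturbed evolution family -/

theorem Summable.tsum_eq_tsum_sum_antidiagonal {F : Type*} [NormedAddCommGroup F]
    [CompleteSpace F] {a : ℕ × ℕ → F} (h : Summable a) :
    ∑' p, a p = ∑' n, ∑ p ∈ Finset.HasAntidiagonal.antidiagonal n, a p := by
  conv_rhs => congr; ext; rw [← Finset.sum_finset_coe, ← tsum_fintype (L := .unconditional _)]
  rw [← Finset.HasAntidiagonal.sigmaAntidiagonalEquivProd.tsum_eq a]
  exact (Finset.HasAntidiagonal.sigmaAntidiagonalEquivProd.summable_iff.2 h).tsum_sigma'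
    fun n => (hasSum_fintype _).summable

section PerturbedEvolution

variable {E : Type*} [NormedAddCommGroup E] [NormedSpace ℝ E] [PartialOrder E]
  [IsOrderedAddMonoid E] [IsOrderedModule ℝ E] [OrderClosedTopology E] {M : ℝ}
  {U : ℝ → ℝ → E →L[ℝ] E} {B : ℝ → E →ₗ.[ℝ] E}

namespace IsPerturbedFamily

/-- Every iterate is positive, contractive on the cone and strongly continuous. -/
theorem dysonPhillips_isSubstochasticFamily (h : IsPerturbedFamily U B)
    (hM : HasDecomposition E M) (n : ℕ) : IsSubstochasticFamily (dysonPhillips U B n) := by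
  induction n with
  | zero => exact h.isSubstochasticFamily
  | succ n ih => exact ih.dysonStep_isSubstochasticFamily h hM

/-- The mass lost by `U` bounds the total mass of the higher iterates. -/
theorem sum_norm_dysonPhillips_succ_le (h : IsPerturbedFamily U B) (hM : HasDecomposition E M)
    (n : ℕ) {t s : ℝ} (hs : 0 ≤ s) (hst : s ≤ t) {u : E} (hu : 0 ≤ u) :
    ∑ k ∈ Finset.range n, ‖dysonPhillips U B (k + 1) t s u‖ ≤ ‖u‖ - ‖U t s u‖ := by
  induction n generalizing t s u with
  | zero => simpa using h.norm_le t s hs hst u hu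
  | succ n ih =>
    have hI : ∀ k, IntervalIntegrable
        (fun r => dysonPhillips U B k t r ((B r).val (U r s u))) volume s t := fun k =>
      (h.dysonPhillips_isSubstochasticFamily hM k).intervalIntegrable_comp h hM hs le_rfl hst
        le_rfl u
    calc ∑ k ∈ Finset.range (n + 1), ‖dysonPhillips U B (k + 1) t s u‖
        ≤ ∑ k ∈ Finset.range (n + 1),
            ∫ r in s..t, ‖dysonPhillips U B k t r ((B r).val (U r s u))‖ :=
          Finset.sum_le_sum fun k _ => intervalIntegral.norm_integral_le_integral_norm hst
      _ = ∫ r in s..t, ∑ k ∈ Finset.range (n + 1),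
            ‖dysonPhillips U B k t r ((B r).val (U r s u))‖ :=
          (intervalIntegral.integral_finsetSum fun k _ => (hI k).norm).symm
      _ ≤ ∫ r in s..t, ‖(B r).val (U r s u)‖ := by
          refine intervalIntegral.integral_mono_on hst
            ?_ ?_ fun r hr => ?_
          · have := IntervalIntegrable.sum (Finset.range (n + 1)) fun k _ => (hI k).norm
            simpa only [Finset.sum_fn] using this
          · rw [intervalIntegrable_iff_integrableOn_Icc_of_le hst]
            exact ((h.integrableOn_Ici hM hs u).mono_set Icc_subset_Ici_self).norm
          · have hr0 := hs.trans hr.1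
            have := ih hr0 hr.2 (h.val_nonneg hr0 (h.nonneg r s hs hr.1 u hu))
            rw [Finset.sum_range_succ']
            exact le_sub_iff_add_le.1 this
      _ ≤ _ := h.integral_norm_le hs hst hu

theorem summable_norm_dysonPhillips_of_nonneg (h : IsPerturbedFamily U B)
    (hM : HasDecomposition E M) {t s : ℝ} (hs : 0 ≤ s) (hst : s ≤ t) {u : E} (hu : 0 ≤ u) :
    Summable fun n => ‖dysonPhillips U B n t s u‖ :=
  (summable_nat_add_iff 1).1 (summable_of_sum_range_le (fun _ => norm_nonneg _)
    fun n => h.sum_norm_dysonPhillips_succ_le hM n hs hst hu)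

theorem tsum_norm_dysonPhillips_le_of_nonneg (h : IsPerturbedFamily U B)
    (hM : HasDecomposition E M) {t s : ℝ} (hs : 0 ≤ s) (hst : s ≤ t) {u : E} (hu : 0 ≤ u) :
    ∑' n, ‖dysonPhillips U B n t s u‖ ≤ ‖u‖ := by
  rw [(h.summable_norm_dysonPhillips_of_nonneg hM hs hst hu).tsum_eq_zero_add]
  have := Real.tsum_le_of_sum_range_le (fun _ => norm_nonneg _)
    fun n => h.sum_norm_dysonPhillips_succ_le hM n hs hst hu
  simp only [dysonPhillips] at this ⊢
  linarith

theorem summable_norm_dysonPhillips (h : IsPerturbedFamily U B) (hM : HasDecomposition E M)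
    {t s : ℝ} (hs : 0 ≤ s) (hst : s ≤ t) (u : E) :
    Summable fun n => ‖dysonPhillips U B n t s u‖ := by
  obtain ⟨v, w, hv, hw, rfl, -⟩ := hM.2 u
  refine Summable.of_nonneg_of_le (fun _ => norm_nonneg _) (fun n => ?_)
    ((h.summable_norm_dysonPhillips_of_nonneg hM hs hst hv).add
      (h.summable_norm_dysonPhillips_of_nonneg hM hs hst hw))
  rw [(h.dysonPhillips_isSubstochasticFamily hM n).sub hs hst]
  exact norm_sub_le _ _

theorem tsum_norm_dysonPhillips_le (h : IsPerturbedFamily U B) (hM : HasDecomposition E M)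
    {t s : ℝ} (hs : 0 ≤ s) (hst : s ≤ t) (u : E) :
    ∑' n, ‖dysonPhillips U B n t s u‖ ≤ M * ‖u‖ := by
  obtain ⟨v, w, hv, hw, rfl, hn⟩ := hM.2 u
  have h1 := h.summable_norm_dysonPhillips_of_nonneg hM hs hst hv
  have h2 := h.summable_norm_dysonPhillips_of_nonneg hM hs hst hw
  refine (Summable.tsum_le_tsum (fun n => ?_) (h.summable_norm_dysonPhillips hM hs hst _)
    (h1.add h2)).trans ?_
  · rw [(h.dysonPhillips_isSubstochasticFamily hM n).sub hs hst]
    exact norm_sub_le _ _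
  · rw [h1.tsum_add h2]
    exact (add_le_add (h.tsum_norm_dysonPhillips_le_of_nonneg hM hs hst hv)
      (h.tsum_norm_dysonPhillips_le_of_nonneg hM hs hst hw)).trans hn

theorem perturbedFamily_nonneg (h : IsPerturbedFamily U B) (hM : HasDecomposition E M)
    {t s : ℝ} (hs : 0 ≤ s) (hst : s ≤ t) {u : E} (hu : 0 ≤ u) : 0 ≤ perturbedFamily U B t s u :=
  tsum_nonneg fun n => (h.dysonPhillips_isSubstochasticFamily hM n).nonneg t s hs hst u hu

theorem norm_perturbedFamily_le (h : IsPerturbedFamily U B) (hM : HasDecomposition E M)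
    {t s : ℝ} (hs : 0 ≤ s) (hst : s ≤ t) (u : E) : ‖perturbedFamily U B t s u‖ ≤ M * ‖u‖ :=
  (norm_tsum_le_tsum_norm (h.summable_norm_dysonPhillips hM hs hst u)).trans
    (h.tsum_norm_dysonPhillips_le hM hs hst u)

theorem norm_perturbedFamily_le_of_nonneg (h : IsPerturbedFamily U B) (hM : HasDecomposition E M)
    {t s : ℝ} (hs : 0 ≤ s) (hst : s ≤ t) {u : E} (hu : 0 ≤ u) :
    ‖perturbedFamily U B t s u‖ ≤ ‖u‖ :=
  (norm_tsum_le_tsum_norm (h.summable_norm_dysonPhillips hM hs hst u)).trans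
    (h.tsum_norm_dysonPhillips_le_of_nonneg hM hs hst hu)

variable [CompleteSpace E]

theorem summable_dysonPhillips (h : IsPerturbedFamily U B) (hM : HasDecomposition E M)
    {t s : ℝ} (hs : 0 ≤ s) (hst : s ≤ t) (u : E) :
    Summable fun n => dysonPhillips U B n t s u :=
  (h.summable_norm_dysonPhillips hM hs hst u).of_norm

theorem perturbedFamily_add (h : IsPerturbedFamily U B) (hM : HasDecomposition E M)
    {t s : ℝ} (hs : 0 ≤ s) (hst : s ≤ t) (u v : E) :
    perturbedFamily U B t s (u + v) = perturbedFamily U B t s u + perturbedFamily U B t s v := by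
  rw [perturbedFamily, perturbedFamily, perturbedFamily,
    ← (h.summable_dysonPhillips hM hs hst u).tsum_add (h.summable_dysonPhillips hM hs hst v)]
  exact tsum_congr fun n => (h.dysonPhillips_isSubstochasticFamily hM n).add t s hs hst u v

theorem perturbedFamily_smul (h : IsPerturbedFamily U B) (hM : HasDecomposition E M)
    {t s : ℝ} (hs : 0 ≤ s) (hst : s ≤ t) (c : ℝ) (u : E) :
    perturbedFamily U B t s (c • u) = c • perturbedFamily U B t s u := by
  rw [perturbedFamily, perturbedFamily,
    ← (h.summable_dysonPhillips hM hs hst u).tsum_const_smul]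
  exact tsum_congr fun n => (h.dysonPhillips_isSubstochasticFamily hM n).smul t s hs hst c u

theorem perturbedFamily_eq_add_tsum (h : IsPerturbedFamily U B) (hM : HasDecomposition E M)
    {t s : ℝ} (hs : 0 ≤ s) (hst : s ≤ t) (u : E) :
    perturbedFamily U B t s u = U t s u + ∑' n, dysonPhillips U B (n + 1) t s u := by
  rw [perturbedFamily, (h.summable_dysonPhillips hM hs hst u).tsum_eq_zero_add]
  rfl

theorem norm_perturbedFamily_sub_le (h : IsPerturbedFamily U B) (hM : HasDecomposition E M)
    {t s : ℝ} (hs : 0 ≤ s) (hst : s ≤ t) {u : E} (hu : 0 ≤ u) :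
    ‖perturbedFamily U B t s u - U t s u‖ ≤ ‖u‖ - ‖U t s u‖ := by
  rw [h.perturbedFamily_eq_add_tsum hM hs hst, add_sub_cancel_left]
  refine (norm_tsum_le_tsum_norm ((summable_nat_add_iff (f := fun n =>
    ‖dysonPhillips U B n t s u‖) 1).2 (h.summable_norm_dysonPhillips hM hs hst u))).trans ?_
  exact Real.tsum_le_of_sum_range_le (fun _ => norm_nonneg _)
    fun n => h.sum_norm_dysonPhillips_succ_le hM n hs hst hu

/-- The perturbed family inherits continuity at the diagonal: on the cone its distance to `U` is
at most the mass lost by `U`, which tends to `0`. -/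
theorem tendsto_perturbedFamily_diagonal (h : IsPerturbedFamily U B) (hM : HasDecomposition E M)
    {s : ℝ} (hs : 0 ≤ s) (u : E) :
    Tendsto (fun p : ℝ × ℝ => perturbedFamily U B p.1 p.2 u) (𝓝[evolutionIndex] (s, s))
      (𝓝 u) := by
  have hU : ∀ v : E, Tendsto (fun p : ℝ × ℝ => U p.1 p.2 v) (𝓝[evolutionIndex] (s, s)) (𝓝 v) :=
    fun v => by
      have := (h.evolution.continuousOn v (s, s) ⟨hs, le_rfl⟩).tendsto
      simpa only [h.evolution.refl s hs, ContinuousLinearMap.id_apply] using this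
  have key : ∀ v : E, 0 ≤ v → Tendsto (fun p : ℝ × ℝ => perturbedFamily U B p.1 p.2 v)
      (𝓝[evolutionIndex] (s, s)) (𝓝 v) := fun v hv => by
    have h1 := (tendsto_const_nhds (x := ‖v‖)).sub (hU v).norm
    rw [sub_self] at h1
    have h2 : Tendsto (fun p : ℝ × ℝ => perturbedFamily U B p.1 p.2 v - U p.1 p.2 v)
        (𝓝[evolutionIndex] (s, s)) (𝓝 0) := by
      refine squeeze_zero_norm' ?_ h1
      filter_upwards [self_mem_nhdsWithin] with p hp
      exact h.norm_perturbedFamily_sub_le hM hp.1 hp.2 hv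
    simpa using h2.add (hU v)
  obtain ⟨v, w, hv, hw, rfl, -⟩ := hM.2 u
  refine ((key v hv).sub (key w hw)).congr' ?_
  filter_upwards [self_mem_nhdsWithin] with p hp
  have := h.perturbedFamily_add hM hp.1 hp.2 (v - w) w
  rw [sub_add_cancel] at this
  rw [this, add_sub_cancel_right]

theorem perturbedFamily_refl (h : IsPerturbedFamily U B) (hM : HasDecomposition E M)
    {t : ℝ} (ht : 0 ≤ t) (u : E) : perturbedFamily U B t t u = u := by
  rw [h.perturbedFamily_eq_add_tsum hM ht le_rfl, h.evolution.refl t ht]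
  simp [dysonPhillips]

/-- The evolution law of `U` turns into a Cauchy product for the iterates. -/
theorem dysonPhillips_eq_sum_antidiagonal (h : IsPerturbedFamily U B) (hM : HasDecomposition E M)
    (n : ℕ) {t r s : ℝ} (hs : 0 ≤ s) (hsr : s ≤ r) (hrt : r ≤ t) (u : E) :
    dysonPhillips U B n t s u = ∑ p ∈ Finset.HasAntidiagonal.antidiagonal n,
      dysonPhillips U B p.1 t r (dysonPhillips U B p.2 r s u) := by
  induction n generalizing s u with
  | zero =>
    simp only [dysonPhillips, Finset.Nat.antidiagonal_zero, Finset.sum_singleton,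
      h.evolution.comp t r s hs hsr hrt, ContinuousLinearMap.comp_apply]
  | succ n ih =>
    have hr := hs.trans hsr
    rw [Finset.Nat.sum_antidiagonal_succ']
    refine ((h.dysonPhillips_isSubstochasticFamily hM n).dysonStep_split h hM hs hsr hrt u).trans ?_
    rw [add_comm]
    congr 1
    calc ∫ ρ in s..r, dysonPhillips U B n t ρ ((B ρ).val (U ρ s u))
        = ∫ ρ in s..r, ∑ p ∈ Finset.HasAntidiagonal.antidiagonal n, dysonPhillips U B p.1 t r
            (dysonPhillips U B p.2 r ρ ((B ρ).val (U ρ s u))) := by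
          refine intervalIntegral.integral_congr fun ρ hρ => ?_
          rw [uIcc_of_le hsr] at hρ
          exact ih (hs.trans hρ.1) hρ.2 _
      _ = ∑ p ∈ Finset.HasAntidiagonal.antidiagonal n, ∫ ρ in s..r, dysonPhillips U B p.1 t r
            (dysonPhillips U B p.2 r ρ ((B ρ).val (U ρ s u))) := by
          refine intervalIntegral.integral_finsetSum fun p _ => ?_
          obtain ⟨L, hL⟩ := (h.dysonPhillips_isSubstochasticFamily hM p.1).exists_clm hM hr hrt
          simp_rw [← hL]
          have hi := (h.dysonPhillips_isSubstochasticFamily hM p.2).intervalIntegrable_comp h hM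
            hs le_rfl hsr le_rfl u
          rw [intervalIntegrable_iff_integrableOn_Ioc_of_le hsr] at hi ⊢
          exact L.integrable_comp hi
      _ = _ := by
          refine Finset.sum_congr rfl fun p _ => ?_
          obtain ⟨L, hL⟩ := (h.dysonPhillips_isSubstochasticFamily hM p.1).exists_clm hM hr hrt
          simp_rw [← hL]
          exact L.intervalIntegral_comp_comm
            ((h.dysonPhillips_isSubstochasticFamily hM p.2).intervalIntegrable_comp h hM
              hs le_rfl hsr le_rfl u)

theorem summable_dysonPhillips_comp (h : IsPerturbedFamily U B) (hM : HasDecomposition E M)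
    {t r s : ℝ} (hs : 0 ≤ s) (hsr : s ≤ r) (hrt : r ≤ t) (u : E) :
    Summable fun p : ℕ × ℕ => dysonPhillips U B p.1 t r (dysonPhillips U B p.2 r s u) := by
  have hr := hs.trans hsr
  -- The norms are summed over the outer iterate first, with bound `M ‖V_j(r,s)u‖`.
  have hsw : Summable fun p : ℕ × ℕ =>
      ‖dysonPhillips U B p.2 t r (dysonPhillips U B p.1 r s u)‖ := by
    refine (summable_prod_of_nonneg fun _ => norm_nonneg _).2
      ⟨fun j => h.summable_norm_dysonPhillips hM hr hrt (dysonPhillips U B j r s u), ?_⟩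
    exact Summable.of_nonneg_of_le (fun _ => tsum_nonneg fun _ => norm_nonneg _)
      (fun j => h.tsum_norm_dysonPhillips_le hM hr hrt (dysonPhillips U B j r s u))
      ((h.summable_norm_dysonPhillips hM hs hsr u).mul_left M)
  exact Summable.of_norm hsw.prod_symm

/-- The evolution law of the perturbed family, from the Cauchy product of the two series. -/
theorem perturbedFamily_comp (h : IsPerturbedFamily U B) (hM : HasDecomposition E M)
    {t r s : ℝ} (hs : 0 ≤ s) (hsr : s ≤ r) (hrt : r ≤ t) (u : E) :
    perturbedFamily U B t s u = perturbedFamily U B t r (perturbedFamily U B r s u) := by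
  have hr := hs.trans hsr
  have hsum := h.summable_dysonPhillips_comp hM hs hsr hrt u
  calc perturbedFamily U B t s u = ∑' n, ∑ p ∈ Finset.HasAntidiagonal.antidiagonal n,
        dysonPhillips U B p.1 t r (dysonPhillips U B p.2 r s u) :=
        tsum_congr fun n => h.dysonPhillips_eq_sum_antidiagonal hM n hs hsr hrt u
    _ = ∑' p : ℕ × ℕ, dysonPhillips U B p.1 t r (dysonPhillips U B p.2 r s u) :=
        hsum.tsum_eq_tsum_sum_antidiagonal.symm
    _ = ∑' k, ∑' j, dysonPhillips U B k t r (dysonPhillips U B j r s u) := hsum.tsum_prod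
    _ = _ := by
        refine tsum_congr fun k => ?_
        obtain ⟨L, hL⟩ := (h.dysonPhillips_isSubstochasticFamily hM k).exists_clm hM hr hrt
        simp only [← hL, perturbedFamily]
        exact (L.map_tsum (h.summable_dysonPhillips hM hs hsr u)).symm

/-- As a pointwise limit of the partial sums, which are continuous, the perturbed family preserves
measurability. -/
theorem perturbedFamily_isMeasurableFamily (h : IsPerturbedFamily U B)
    (hM : HasDecomposition E M) : IsMeasurableFamily (perturbedFamily U B) := by
  intro α _ μ a b g ha hb hab hg
  refine aestronglyMeasurable_of_tendsto_ae atTop (f := fun n x =>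
    ∑ k ∈ Finset.range n, dysonPhillips U B k (a x) (b x) (g x)) (fun n => ?_) ?_
  · exact Finset.aestronglyMeasurable_fun_sum _ fun k _ =>
      (h.dysonPhillips_isSubstochasticFamily hM k).isMeasurableFamily hM α μ a b g ha hb hab hg
  · filter_upwards [hab] with x hx
    exact (h.summable_dysonPhillips hM hx.1 hx.2 (g x)).hasSum.tendsto_sum_nat

/-- Duhamel's formula. -/
theorem perturbedFamily_eq_add_integral (h : IsPerturbedFamily U B) (hM : HasDecomposition E M)
    {t s : ℝ} (hs : 0 ≤ s) (hst : s ≤ t) (u : E) :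
    perturbedFamily U B t s u =
      U t s u + ∫ r in s..t, perturbedFamily U B t r ((B r).val (U r s u)) := by
  rw [h.perturbedFamily_eq_add_tsum hM hs hst]
  congr 1
  have hI : ∀ k, IntervalIntegrable
      (fun r => dysonPhillips U B k t r ((B r).val (U r s u))) volume s t := fun k =>
    (h.dysonPhillips_isSubstochasticFamily hM k).intervalIntegrable_comp h hM hs le_rfl hst
      le_rfl u
  have hβ : IntervalIntegrable (fun r => (B r).val (U r s u)) volume s t := by
    rw [intervalIntegrable_iff_integrableOn_Icc_of_le hst]
    exact (h.integrableOn_Ici hM hs u).mono_set Icc_subset_Ici_self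
  have hS : ∀ r ∈ uIoc s t,
      Summable fun k => ‖dysonPhillips U B k t r ((B r).val (U r s u))‖ := fun r hr => by
    rw [uIoc_of_le hst] at hr
    exact h.summable_norm_dysonPhillips hM (hs.trans hr.1.le) hr.2 _
  refine HasSum.tsum_eq (intervalIntegral.hasSum_integral_of_dominated_convergence
    (fun k r => ‖dysonPhillips U B k t r ((B r).val (U r s u))‖) (fun k => ?_) (fun k => ?_) ?_ ?_
    ?_)
  · exact (hI k).aestronglyMeasurable_restrict_uIoc
  · exact Eventually.of_forall fun r _ => le_rfl
  · exact Eventually.of_forall hS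
  · refine (hβ.norm.const_mul M).mono_fun' ?_ ?_
    · refine aestronglyMeasurable_of_tendsto_ae atTop (f := fun n r =>
        ∑ k ∈ Finset.range n, ‖dysonPhillips U B k t r ((B r).val (U r s u))‖) (fun n => ?_) ?_
      · exact Finset.aestronglyMeasurable_fun_sum _ fun k _ =>
          (hI k).aestronglyMeasurable_restrict_uIoc.norm
      · filter_upwards [ae_restrict_mem measurableSet_uIoc] with r hr
        exact (hS r hr).hasSum.tendsto_sum_nat
    · filter_upwards [ae_restrict_mem measurableSet_uIoc] with r hr
      rw [uIoc_of_le hst] at hr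
      rw [Real.norm_of_nonneg (tsum_nonneg fun _ => norm_nonneg _)]
      exact h.tsum_norm_dysonPhillips_le hM (hs.trans hr.1.le) hr.2 _
  · refine Eventually.of_forall fun r hr => ?_
    exact (hS r hr).of_norm.hasSum

end IsPerturbedFamily

end PerturbedEvolution

/-! ### Operators on `L¹` given by pointwise formulas -/

section LiftedOperators

variable {E : Type*} [NormedAddCommGroup E]

theorem ae_halfLine_iff {p : ℝ → Prop} :
    (∀ᵐ s ∂halfLineMeasure, p s) ↔ ∀ᵐ s, 0 ≤ s → p s :=
  ae_restrict_iff' measurableSet_Ici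

/-- A property of almost every point of the half line holds at `s - t` for almost every `s ≥ t`. -/
theorem ae_shift {p : ℝ → Prop} (h : ∀ᵐ s ∂halfLineMeasure, p s) (t : ℝ) :
    ∀ᵐ s, t ≤ s → p (s - t) := by
  filter_upwards [(measurePreserving_sub_right volume t).quasiMeasurePreserving.ae
    (ae_halfLine_iff.1 h)] with s hs hts using hs (sub_nonneg.2 hts)

theorem lintegral_shift (g : ℝ → ENNReal) (t : ℝ) :
    ∫⁻ s in Ici t, g (s - t) = ∫⁻ s, g s ∂halfLineMeasure := by
  rw [halfLineMeasure, ← lintegral_indicator measurableSet_Ici,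
    ← lintegral_indicator measurableSet_Ici,
    ← lintegral_sub_right_eq_self ((Ici (0 : ℝ)).indicator g) t]
  refine lintegral_congr fun s => ?_
  by_cases hs : t ≤ s
  · rw [indicator_of_mem (show s ∈ Ici t from hs),
      indicator_of_mem (show s - t ∈ Ici 0 from sub_nonneg.2 hs)]
  · rw [indicator_of_notMem (show s ∉ Ici t from hs),
      indicator_of_notMem (show s - t ∉ Ici 0 from fun h => hs (sub_nonneg.1 h))]

theorem lintegral_evolutionFormula_le_of_ae {W : ℝ → ℝ → E → E} {C t : ℝ} (ht : 0 ≤ t)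
    {f : LiftedSpace E} (hf : ∀ᵐ s ∂halfLineMeasure,
      ‖W (s + t) s (f s)‖ₑ ≤ ENNReal.ofReal C * ‖f s‖ₑ) :
    ∫⁻ s, ‖evolutionFormula W t f s‖ₑ ∂halfLineMeasure ≤
      ENNReal.ofReal C * ∫⁻ s, ‖f s‖ₑ ∂halfLineMeasure := by
  rw [← lintegral_const_mul' _ _ ENNReal.ofReal_ne_top,
    ← lintegral_shift (fun s => ENNReal.ofReal C * ‖f s‖ₑ) t,
    ← lintegral_indicator measurableSet_Ici]
  refine (lintegral_indicator measurableSet_Ici _).symm.trans_le ?_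
  refine lintegral_mono_ae ?_
  filter_upwards [ae_shift hf t] with s hfs
  by_cases hs : t ≤ s
  · rw [indicator_of_mem (show s ∈ Ici t from hs),
      indicator_of_mem (show s ∈ Ici 0 from ht.trans hs), evolutionFormula, if_pos hs]
    simpa only [sub_add_cancel] using hfs hs
  · simp [indicator, evolutionFormula, hs]

variable [NormedSpace ℝ E]

theorem IsGivenBy.norm_le {L : LiftedSpace E →L[ℝ] LiftedSpace E} {Φ : LiftedSpace E → ℝ → E}
    (h : IsGivenBy L Φ) {C : ℝ} (hC : 0 ≤ C) {f : LiftedSpace E}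
    (hf : ∫⁻ s, ‖Φ f s‖ₑ ∂halfLineMeasure ≤
      ENNReal.ofReal C * ∫⁻ s, ‖f s‖ₑ ∂halfLineMeasure) : ‖L f‖ ≤ C * ‖f‖ := by
  rw [L1.norm_def, L1.norm_def, lintegral_congr_ae (f := fun s => ‖L f s‖ₑ)
    (g := fun s => ‖Φ f s‖ₑ) ((h f).fun_comp enorm)]
  refine (ENNReal.toReal_mono (ENNReal.mul_ne_top ENNReal.ofReal_ne_top
    (L1.integrable_coeFn f).hasFiniteIntegral.ne) hf).trans ?_
  rw [ENNReal.toReal_mul, ENNReal.toReal_ofReal hC]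

/-- A pointwise formula that is a.e. linear and bounded in `L¹` defines a bounded operator. The
formula is evaluated at the chosen representative of each element of `L¹`, so linearity is required
only almost everywhere. -/
theorem exists_isGivenBy {Φ : LiftedSpace E → ℝ → E} {C : ℝ} (hC : 0 ≤ C)
    (hmeas : ∀ f, AEStronglyMeasurable (Φ f) halfLineMeasure)
    (hadd : ∀ f g, Φ (f + g) =ᵐ[halfLineMeasure] fun s => Φ f s + Φ g s)
    (hsmul : ∀ (c : ℝ) f, Φ (c • f) =ᵐ[halfLineMeasure] fun s => c • Φ f s)
    (hbound : ∀ f, ∫⁻ s, ‖Φ f s‖ₑ ∂halfLineMeasure ≤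
      ENNReal.ofReal C * ∫⁻ s, ‖f s‖ₑ ∂halfLineMeasure) :
    ∃ L, IsGivenBy L Φ := by
  have hfin : ∀ f : LiftedSpace E,
      ENNReal.ofReal C * ∫⁻ s, ‖f s‖ₑ ∂halfLineMeasure ≠ ⊤ := fun f =>
    ENNReal.mul_ne_top ENNReal.ofReal_ne_top (L1.integrable_coeFn f).hasFiniteIntegral.ne
  have hint : ∀ f, Integrable (Φ f) halfLineMeasure := fun f =>
    ⟨hmeas f, (hbound f).trans_lt (hfin f).lt_top⟩
  let L : LiftedSpace E →ₗ[ℝ] LiftedSpace E :=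
    { toFun := fun f => (hint f).toL1
      map_add' := fun f g => by
        rw [← Integrable.toL1_add, Integrable.toL1_eq_toL1_iff]
        exact hadd f g
      map_smul' := fun c f => by
        rw [RingHom.id_apply, ← Integrable.toL1_smul, Integrable.toL1_eq_toL1_iff]
        exact hsmul c f }
  refine ⟨L.mkContinuous C fun f => ?_, fun f => (hint f).coeFn_toL1⟩
  change ‖(hint f).toL1‖ ≤ C * ‖f‖
  rw [L1.norm_def, L1.norm_def, lintegral_congr_ae
    (f := fun s => ‖((hint f).toL1 : LiftedSpace E) s‖ₑ) (g := fun s => ‖Φ f s‖ₑ)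
    ((hint f).coeFn_toL1.fun_comp enorm)]
  refine (ENNReal.toReal_mono (hfin f) (hbound f)).trans ?_
  rw [ENNReal.toReal_mul, ENNReal.toReal_ofReal hC]

theorem operatorOf_isGivenBy {Φ : LiftedSpace E → ℝ → E} (h : ∃ L, IsGivenBy L Φ) :
    IsGivenBy (operatorOf Φ) Φ := by
  rw [operatorOf, dif_pos h]
  exact h.choose_spec

end LiftedOperators

/-! ### A criterion for strong continuity of semigroups -/

section SemigroupCriterion

variable {F : Type*} [NormedAddCommGroup F] [NormedSpace ℝ F]

/-- For a bounded semigroup, strong right continuity at `0` gives strong continuity everywhere. -/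
theorem isC0Semigroup_of_tendsto {T : ℝ → F →L[ℝ] F} {C : ℝ}
    (hzero : T 0 = ContinuousLinearMap.id ℝ F)
    (hadd : ∀ t s : ℝ, 0 ≤ t → 0 ≤ s → T (t + s) = (T t).comp (T s))
    (hbound : ∀ t, 0 ≤ t → ∀ f, ‖T t f‖ ≤ C * ‖f‖)
    (hT : ∀ f, Tendsto (fun t => T t f) (𝓝[>] 0) (𝓝 f)) : IsC0Semigroup T := by
  refine ⟨hzero, hadd, fun f t₀ ht₀ => ?_⟩
  have ht₀ : 0 ≤ t₀ := ht₀
  have hC : 0 ≤ |C| := abs_nonneg C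
  have hT' : Tendsto (fun t => T |t| f) (𝓝 0) (𝓝 f) := by
    rw [Metric.tendsto_nhds_nhds]
    intro ε hε
    obtain ⟨δ, hδ, h⟩ := Metric.tendsto_nhdsWithin_nhds.1 (hT f) ε hε
    refine ⟨δ, hδ, fun {t} ht => ?_⟩
    rcases eq_or_ne t 0 with rfl | h0
    · simpa [hzero] using hε
    · exact h (abs_pos.2 h0) (by simpa using ht)
  rw [ContinuousWithinAt, tendsto_iff_norm_sub_tendsto_zero]
  have hlim : Tendsto (fun t => |C| * ‖T |t - t₀| f - f‖) (𝓝[Ici 0] t₀) (𝓝 0) := by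
    have h1 : Tendsto (fun t => t - t₀) (𝓝[Ici 0] t₀) (𝓝 0) := by
      have : Continuous fun t : ℝ => t - t₀ := by fun_prop
      simpa using (this.tendsto t₀).mono_left nhdsWithin_le_nhds
    simpa using (((hT'.comp h1).sub_const f).norm).const_mul |C|
  refine squeeze_zero' (Eventually.of_forall fun _ => norm_nonneg _) ?_ hlim
  filter_upwards [self_mem_nhdsWithin] with t ht
  have key : ∀ a b : ℝ, 0 ≤ a → a ≤ b → ‖T b f - T a f‖ ≤ |C| * ‖T (b - a) f - f‖ := by
    intro a b ha hab
    have h1 : T b f = T a (T (b - a) f) := by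
      rw [← ContinuousLinearMap.comp_apply, ← hadd a (b - a) ha (sub_nonneg.2 hab),
        add_sub_cancel]
    rw [h1, ← map_sub]
    exact (hbound a ha _).trans (mul_le_mul_of_nonneg_right (le_abs_self C) (norm_nonneg _))
  rcases le_total t t₀ with hle | hle
  · rw [abs_of_nonpos (sub_nonpos.2 hle), neg_sub, norm_sub_rev]
    exact key t t₀ ht hle
  · rw [abs_of_nonneg (sub_nonneg.2 hle)]
    exact key t₀ t ht₀ hle

end SemigroupCriterion

/-! ### Evolution semigroups -/

section EvolutionSemigroup

variable {E : Type*} [NormedAddCommGroup E] [NormedSpace ℝ E]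

/-- A bounded, strongly measurable evolution family that is strongly continuous at the diagonal.
Joint continuity is not required; the perturbed family has only these properties. -/
structure IsMeasurableEvolution (W : ℝ → ℝ → E → E) (M : ℝ) : Prop where
  add : ∀ t s : ℝ, 0 ≤ s → s ≤ t → ∀ u v, W t s (u + v) = W t s u + W t s v
  smul : ∀ t s : ℝ, 0 ≤ s → s ≤ t → ∀ (c : ℝ) u, W t s (c • u) = c • W t s u
  bound_nonneg : 0 ≤ M
  norm_le : ∀ t s : ℝ, 0 ≤ s → s ≤ t → ∀ u, ‖W t s u‖ ≤ M * ‖u‖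
  refl : ∀ t : ℝ, 0 ≤ t → ∀ u, W t t u = u
  comp : ∀ t r s : ℝ, 0 ≤ s → s ≤ r → r ≤ t → ∀ u, W t s u = W t r (W r s u)
  measurable : IsMeasurableFamily W
  diagonal : ∀ s : ℝ, 0 ≤ s → ∀ u,
    Tendsto (fun p : ℝ × ℝ => W p.1 p.2 u) (𝓝[evolutionIndex] (s, s)) (𝓝 u)

namespace IsMeasurableEvolution

variable {W : ℝ → ℝ → E → E} {M : ℝ}

theorem map_zero (hW : IsMeasurableEvolution W M) {t s : ℝ} (hs : 0 ≤ s) (hst : s ≤ t) :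
    W t s 0 = 0 := by
  simpa using hW.smul t s hs hst 0 0

theorem aestronglyMeasurable_evolutionFormula (hW : IsMeasurableEvolution W M) {t : ℝ}
    (ht : 0 ≤ t) (f : LiftedSpace E) :
    AEStronglyMeasurable (evolutionFormula W t f) halfLineMeasure := by
  have heq : evolutionFormula W t f = (Ici t).indicator fun s => W s (s - t) (f (s - t)) := by
    ext s
    by_cases hs : t ≤ s <;> simp [evolutionFormula, hs]
  rw [heq, aestronglyMeasurable_indicator_iff measurableSet_Ici]
  refine hW.measurable ℝ _ id (fun s => s - t) (fun s => f (s - t)) aemeasurable_id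
    (by fun_prop) ?_ ?_
  · filter_upwards [ae_restrict_mem measurableSet_Ici] with s hs
    exact ⟨sub_nonneg.2 hs, sub_le_self _ ht⟩
  · exact ((Lp.stronglyMeasurable f).comp_measurable
      (measurable_id.sub_const t)).aestronglyMeasurable

theorem enorm_apply_le (hW : IsMeasurableEvolution W M) {t s : ℝ} (hs : 0 ≤ s) (hst : s ≤ t)
    (u : E) : ‖W t s u‖ₑ ≤ ENNReal.ofReal M * ‖u‖ₑ := by
  rw [← ofReal_norm, ← ofReal_norm, ← ENNReal.ofReal_mul hW.bound_nonneg]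
  exact ENNReal.ofReal_le_ofReal (hW.norm_le t s hs hst u)

theorem lintegral_evolutionFormula_le (hW : IsMeasurableEvolution W M) {t : ℝ}
    (ht : 0 ≤ t) (f : LiftedSpace E) :
    ∫⁻ s, ‖evolutionFormula W t f s‖ₑ ∂halfLineMeasure ≤
      ENNReal.ofReal M * ∫⁻ s, ‖f s‖ₑ ∂halfLineMeasure := by
  refine lintegral_evolutionFormula_le_of_ae ht ?_
  filter_upwards [ae_restrict_mem measurableSet_Ici] with s hs
  exact hW.enorm_apply_le hs (le_add_of_nonneg_right ht) _

theorem isGivenBy (hW : IsMeasurableEvolution W M) {t : ℝ} (ht : 0 ≤ t) :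
    IsGivenBy (evolutionSemigroup W t) (evolutionFormula W t) := by
  refine operatorOf_isGivenBy (exists_isGivenBy hW.bound_nonneg
    (hW.aestronglyMeasurable_evolutionFormula ht) (fun f g => ?_) (fun c f => ?_)
    (hW.lintegral_evolutionFormula_le ht))
  · rw [EventuallyEq, ae_halfLine_iff]
    filter_upwards [ae_shift (Lp.coeFn_add f g) t] with s hs _
    by_cases hts : t ≤ s
    · simp only [evolutionFormula, if_pos hts, hs hts, Pi.add_apply]
      exact hW.add _ _ (sub_nonneg.2 hts) (sub_le_self _ ht) _ _
    · simp [evolutionFormula, hts]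
  · rw [EventuallyEq, ae_halfLine_iff]
    filter_upwards [ae_shift (Lp.coeFn_smul c f) t] with s hs _
    by_cases hts : t ≤ s
    · simp only [evolutionFormula, if_pos hts, hs hts, Pi.smul_apply]
      exact hW.smul _ _ (sub_nonneg.2 hts) (sub_le_self _ ht) _ _
    · simp [evolutionFormula, hts]

theorem norm_evolutionSemigroup_le (hW : IsMeasurableEvolution W M) {t : ℝ} (ht : 0 ≤ t)
    (f : LiftedSpace E) : ‖evolutionSemigroup W t f‖ ≤ M * ‖f‖ :=
  (hW.isGivenBy ht).norm_le hW.bound_nonneg (hW.lintegral_evolutionFormula_le ht f)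

theorem evolutionSemigroup_zero (hW : IsMeasurableEvolution W M) :
    evolutionSemigroup W 0 = ContinuousLinearMap.id ℝ (LiftedSpace E) := by
  ext1 f
  refine Lp.ext ?_
  filter_upwards [hW.isGivenBy le_rfl f, ae_restrict_mem measurableSet_Ici] with s hs hs0
  rw [hs, evolutionFormula, if_pos (show (0 : ℝ) ≤ s from hs0), sub_zero]
  exact hW.refl s hs0 _

theorem evolutionSemigroup_add (hW : IsMeasurableEvolution W M) {t r : ℝ} (ht : 0 ≤ t)
    (hr : 0 ≤ r) : evolutionSemigroup W (t + r) =
      (evolutionSemigroup W t).comp (evolutionSemigroup W r) := by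
  ext1 f
  refine Lp.ext ?_
  filter_upwards [hW.isGivenBy (add_nonneg ht hr) f, hW.isGivenBy ht (evolutionSemigroup W r f),
    ae_restrict_of_ae (ae_shift (hW.isGivenBy hr f) t)] with s h1 h2 h3
  rw [ContinuousLinearMap.comp_apply, h1, h2, evolutionFormula, evolutionFormula]
  by_cases hts : t ≤ s
  · rw [if_pos hts, h3 hts, evolutionFormula]
    by_cases hrs : t + r ≤ s
    · have hrs' : r ≤ s - t := by linarith
      rw [if_pos hrs, if_pos hrs', sub_sub]
      exact hW.comp _ _ _ (sub_nonneg.2 hrs) (by linarith) (by linarith) _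
    · have hrs' : ¬ r ≤ s - t := fun h => hrs (by linarith)
      rw [if_neg hrs, if_neg hrs', hW.map_zero (sub_nonneg.2 hts) (sub_le_self _ ht)]
  · rw [if_neg hts, if_neg fun h => hts (by linarith)]

/-- Strong continuity at `0` on continuous functions of compact support, by dominated
convergence. -/
theorem tendsto_evolutionSemigroup_of_continuous (hW : IsMeasurableEvolution W M)
    (f : LiftedSpace E) {g : ℝ → E} (hg : Continuous g) (hgc : HasCompactSupport g)
    (hfg : f =ᵐ[halfLineMeasure] g) :
    Tendsto (fun t => evolutionSemigroup W t f) (𝓝[>] 0) (𝓝 f) := by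
  rw [tendsto_iff_norm_sub_tendsto_zero]
  -- The exceptional null set in `f = g` moves with `t`; writing everything in terms of `g` gives
  -- convergence at every point.
  let Φ : ℝ → ℝ → E := fun t s => if t ≤ s then W s (s - t) (g (s - t)) else 0
  have hΦ : ∀ t : ℝ, 0 ≤ t → evolutionFormula W t f =ᵐ[halfLineMeasure] Φ t := fun t ht => by
    filter_upwards [ae_restrict_of_ae (ae_shift hfg t)] with s hs
    by_cases hts : t ≤ s
    · simp only [evolutionFormula, Φ, if_pos hts, hs hts]
    · simp only [evolutionFormula, Φ, if_neg hts]
  have heq : ∀ t : ℝ, 0 ≤ t → ‖evolutionSemigroup W t f - f‖ =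
      ∫ s, ‖Φ t s - g s‖ ∂halfLineMeasure := fun t ht => by
    rw [L1.norm_eq_integral_norm]
    refine integral_congr_ae ?_
    filter_upwards [Lp.coeFn_sub (evolutionSemigroup W t f) f, hW.isGivenBy ht f, hΦ t ht, hfg]
      with s h1 h2 h3 h4
    rw [h1, Pi.sub_apply, h2, h3, h4]
  obtain ⟨C, hC⟩ := hgc.exists_bound_of_continuous hg
  obtain ⟨R, hR⟩ : ∃ R : ℝ, ∀ s, R < s → g s = 0 := by
    obtain ⟨R, hR⟩ := hgc.isCompact.bddAbove
    refine ⟨R, fun s hs => ?_⟩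
    by_contra h0
    exact absurd (hR (subset_tsupport g h0)) (not_le.2 hs)
  have hC0 : 0 ≤ C := (norm_nonneg _).trans (hC 0)
  have hM := hW.bound_nonneg
  have hlim : Tendsto (fun t => ∫ s, ‖Φ t s - g s‖ ∂halfLineMeasure)
      (𝓝[>] 0) (𝓝 (∫ _, (0 : ℝ) ∂halfLineMeasure)) := by
    refine tendsto_integral_filter_of_dominated_convergence
      ((Iic (R + 1)).indicator fun _ => M * C + C) ?_ ?_ ?_ ?_
    · filter_upwards [self_mem_nhdsWithin] with t ht
      exact (((hW.aestronglyMeasurable_evolutionFormula (le_of_lt ht) f).congr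
        (hΦ t (le_of_lt ht))).sub hg.aestronglyMeasurable).norm
    · have h1 : ∀ᶠ t : ℝ in 𝓝[>] 0, t < 1 :=
        mem_nhdsWithin_of_mem_nhds (Iio_mem_nhds one_pos)
      filter_upwards [self_mem_nhdsWithin, h1] with t ht ht1
      have ht : 0 < t := ht
      refine Eventually.of_forall fun s => ?_
      rw [norm_norm]
      have hb : ‖Φ t s‖ ≤ M * C ∧ (R + 1 < s → Φ t s = 0) := by
        by_cases hts : t ≤ s
        · simp only [Φ, if_pos hts]
          refine ⟨(hW.norm_le _ _ (sub_nonneg.2 hts) (sub_le_self _ ht.le) _).trans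
            (mul_le_mul_of_nonneg_left (hC _) hM), fun hRs => ?_⟩
          rw [hR _ (by linarith), hW.map_zero (sub_nonneg.2 hts) (sub_le_self _ ht.le)]
        · simp only [Φ, if_neg hts]
          exact ⟨by simpa using mul_nonneg hM hC0, fun _ => trivial⟩
      by_cases hRs : s ≤ R + 1
      · rw [indicator_of_mem (show s ∈ Iic (R + 1) from hRs)]
        exact (norm_sub_le _ _).trans (add_le_add hb.1 (hC s))
      · have hRs' : R + 1 < s := not_le.1 hRs
        rw [indicator_of_notMem (show s ∉ Iic (R + 1) from hRs), hb.2 hRs', hR s (by linarith),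
          sub_zero, norm_zero]
    · rw [integrable_indicator_iff measurableSet_Iic]
      refine integrableOn_const (hs := ?_)
      rw [halfLineMeasure, Measure.restrict_apply measurableSet_Iic, Iic_inter_Ici]
      exact measure_Icc_lt_top.ne
    · have h0 : ∀ᵐ s ∂halfLineMeasure, s ≠ 0 := ae_restrict_of_ae
        (measure_eq_zero_iff_ae_notMem.1 (measure_singleton (0 : ℝ) (μ := volume)))
      filter_upwards [ae_restrict_mem measurableSet_Ici, h0] with s hs hs0
      have hs : 0 < s := lt_of_le_of_ne hs (Ne.symm hs0)
      have hev : ∀ᶠ t in 𝓝[>] (0 : ℝ), 0 < t ∧ t ≤ s := by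
        filter_upwards [self_mem_nhdsWithin, mem_nhdsWithin_of_mem_nhds (Iio_mem_nhds hs)]
          with t h1 h2 using ⟨h1, h2.le⟩
      have hshift : Tendsto (fun t : ℝ => s - t) (𝓝[>] 0) (𝓝 s) := by
        have : Continuous fun t : ℝ => s - t := by fun_prop
        simpa using (this.tendsto 0).mono_left nhdsWithin_le_nhds
      have h1 : Tendsto (fun t => M * ‖g (s - t) - g s‖) (𝓝[>] 0) (𝓝 0) := by
        simpa using ((((hg.tendsto s).comp hshift).sub_const (g s)).norm).const_mul M
      have h2 : Tendsto (fun t => ‖W s (s - t) (g s) - g s‖) (𝓝[>] 0) (𝓝 0) := by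
        have h3 : Tendsto (fun t : ℝ => (s, s - t)) (𝓝[>] 0) (𝓝[evolutionIndex] (s, s)) := by
          refine tendsto_nhdsWithin_iff.2 ⟨tendsto_const_nhds.prodMk_nhds hshift, ?_⟩
          filter_upwards [hev] with t ht
          exact ⟨sub_nonneg.2 ht.2, sub_le_self _ ht.1.le⟩
        simpa using (((hW.diagonal s hs.le (g s)).comp h3).sub_const (g s)).norm
      have h3 := h1.add h2
      rw [add_zero] at h3
      refine squeeze_zero' (Eventually.of_forall fun _ => norm_nonneg _) ?_ h3
      filter_upwards [hev] with t ht
      simp only [Φ, if_pos ht.2]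
      have hst : 0 ≤ s - t := sub_nonneg.2 ht.2
      have hts : s - t ≤ s := sub_le_self _ ht.1.le
      have h4 := hW.add s (s - t) hst hts (g (s - t) - g s) (g s)
      rw [sub_add_cancel] at h4
      rw [h4, add_sub_assoc]
      exact (norm_add_le _ _).trans (add_le_add (hW.norm_le _ _ hst hts _) le_rfl)
  rw [integral_zero] at hlim
  refine hlim.congr' ?_
  filter_upwards [self_mem_nhdsWithin] with t ht using (heq t (le_of_lt ht)).symm

/-- Strong continuity at `0`, by density of the continuous functions of compact support. -/
theorem tendsto_evolutionSemigroup (hW : IsMeasurableEvolution W M) (f : LiftedSpace E) :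
    Tendsto (fun t => evolutionSemigroup W t f) (𝓝[>] 0) (𝓝 f) := by
  rw [tendsto_iff_norm_sub_tendsto_zero, Metric.tendsto_nhds]
  intro ε hε
  have hM := hW.bound_nonneg
  have hf : Integrable ((Ici (0 : ℝ)).indicator f) :=
    (integrable_indicator_iff measurableSet_Ici).2 (L1.integrable_coeFn f)
  obtain ⟨g, hgc, hfg, hg, hgi⟩ :=
    hf.exists_hasCompactSupport_integral_sub_le (ε := ε / (2 * (M + 1))) (by positivity)
  have hgi' : Integrable g halfLineMeasure := hgi.restrict
  set k : LiftedSpace E := hgi'.toL1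
  have hfk : ‖f - k‖ ≤ ε / (2 * (M + 1)) := by
    refine le_trans (le_of_eq ?_) ((setIntegral_le_integral (hf.sub hgi).norm
      (Eventually.of_forall fun _ => norm_nonneg _) (s := Ici 0)).trans hfg)
    rw [L1.norm_eq_integral_norm]
    refine integral_congr_ae ?_
    filter_upwards [Lp.coeFn_sub f k, hgi'.coeFn_toL1, ae_restrict_mem measurableSet_Ici]
      with s h1 h2 h3
    rw [h1, Pi.sub_apply, h2, Pi.sub_apply, indicator_of_mem h3]
  have hk := tendsto_iff_norm_sub_tendsto_zero.1
    (hW.tendsto_evolutionSemigroup_of_continuous k hg hgc hgi'.coeFn_toL1)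
  filter_upwards [self_mem_nhdsWithin, Metric.tendsto_nhds.1 hk (ε / 2) (by positivity)]
    with t ht hkt
  rw [dist_zero_right, norm_norm] at hkt ⊢
  have h1 : evolutionSemigroup W t f - f = evolutionSemigroup W t (f - k) +
      (evolutionSemigroup W t k - k) - (f - k) := by
    rw [map_sub]
    abel
  have h2 := hW.norm_evolutionSemigroup_le (le_of_lt ht) (f - k)
  have h3 : (M + 1) * ‖f - k‖ ≤ ε / 2 := by
    calc (M + 1) * ‖f - k‖ ≤ (M + 1) * (ε / (2 * (M + 1))) := by gcongr
      _ = ε / 2 := by field_simp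
  calc ‖evolutionSemigroup W t f - f‖
      ≤ ‖evolutionSemigroup W t (f - k)‖ + ‖evolutionSemigroup W t k - k‖ + ‖f - k‖ := by
        rw [h1]
        exact (norm_sub_le _ _).trans (add_le_add (norm_add_le _ _) le_rfl)
    _ < ε := by linarith

theorem isC0Semigroup (hW : IsMeasurableEvolution W M) : IsC0Semigroup (evolutionSemigroup W) :=
  isC0Semigroup_of_tendsto hW.evolutionSemigroup_zero
    (fun _ _ ht hr => hW.evolutionSemigroup_add ht hr)
    (fun _ ht => hW.norm_evolutionSemigroup_le ht) hW.tendsto_evolutionSemigroup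

end IsMeasurableEvolution

end EvolutionSemigroup

/-! ### Resolvents of bounded semigroups -/

section LaplaceTransform

variable {F : Type*} [NormedAddCommGroup F] [NormedSpace ℝ F]

/-- The Laplace transform `∫₀^∞ exp(-l t) T(t)f dt`, that is, the resolvent at `l` of the generator
of a bounded semigroup. -/
noncomputable def laplaceTransform (T : ℝ → F →L[ℝ] F) (l : ℝ) (f : F) : F :=
  ∫ t in Ioi (0 : ℝ), Real.exp (-l * t) • T t f

namespace IsC0Semigroup

variable {T : ℝ → F →L[ℝ] F} {C l : ℝ}

/-- The orbits, extended to negative times by their value at `0`, are continuous on the line. -/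
theorem continuous_max (hT : IsC0Semigroup T) (f : F) : Continuous fun t => T (max t 0) f :=
  (hT.continuousOn f).comp_continuous (continuous_id.max continuous_const)
    fun _ => mem_Ici.2 (le_max_right _ _)

theorem integrableOn_laplace (hT : IsC0Semigroup T) (hC : ∀ t, 0 ≤ t → ∀ f, ‖T t f‖ ≤ C * ‖f‖)
    (hl : 0 < l) (f : F) : IntegrableOn (fun t => Real.exp (-l * t) • T t f) (Ioi 0) := by
  refine Integrable.mono' ((exp_neg_integrableOn_Ioi 0 hl).mul_const (C * ‖f‖)) ?_ ?_
  · have hc : Continuous fun t => Real.exp (-l * t) • T (max t 0) f :=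
      (by fun_prop : Continuous fun t => Real.exp (-l * t)).smul (hT.continuous_max f)
    refine (hc.continuousOn.aestronglyMeasurable measurableSet_Ioi).congr ?_
    filter_upwards [ae_restrict_mem measurableSet_Ioi] with t ht
    rw [max_eq_left (le_of_lt ht)]
  · filter_upwards [ae_restrict_mem measurableSet_Ioi] with t ht
    rw [norm_smul, Real.norm_of_nonneg (Real.exp_pos _).le]
    exact mul_le_mul_of_nonneg_left (hC t (le_of_lt ht) f) (Real.exp_pos _).le

theorem exists_laplace_clm (hT : IsC0Semigroup T) (hC : ∀ t, 0 ≤ t → ∀ f, ‖T t f‖ ≤ C * ‖f‖)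
    (hl : 0 < l) : ∃ R : F →L[ℝ] F, ∀ f, R f = laplaceTransform T l f := by
  let L : F →ₗ[ℝ] F :=
    { toFun := laplaceTransform T l
      map_add' := fun f g => by
        rw [laplaceTransform, laplaceTransform, laplaceTransform, ← integral_add
          (hT.integrableOn_laplace hC hl f) (hT.integrableOn_laplace hC hl g)]
        simp only [map_add, smul_add]
      map_smul' := fun c f => by
        rw [laplaceTransform, laplaceTransform, RingHom.id_apply, ← integral_smul]
        simp only [map_smul, smul_comm c] }
  refine ⟨L.mkContinuous ((∫ t in Ioi (0 : ℝ), Real.exp (-l * t)) * C) fun f => ?_, fun f => rfl⟩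
  change ‖laplaceTransform T l f‖ ≤ _
  rw [mul_assoc, ← integral_mul_const]
  refine norm_integral_le_of_norm_le ((exp_neg_integrableOn_Ioi 0 hl).mul_const (C * ‖f‖)) ?_
  filter_upwards [ae_restrict_mem measurableSet_Ioi] with t ht
  rw [norm_smul, Real.norm_of_nonneg (Real.exp_pos _).le]
  exact mul_le_mul_of_nonneg_left (hC t (le_of_lt ht) f) (Real.exp_pos _).le

/-- Shifting the variable of integration by `h`. -/
theorem laplace_apply (hT : IsC0Semigroup T) (hC : ∀ t, 0 ≤ t → ∀ f, ‖T t f‖ ≤ C * ‖f‖)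
    (hl : 0 < l) {h : ℝ} (hh : 0 ≤ h) (f : F) :
    laplaceTransform T l (T h f) = Real.exp (l * h) • (laplaceTransform T l f -
      ∫ t in (0 : ℝ)..h, Real.exp (-l * t) • T (max t 0) f) := by
  have h1 : ∫ t in (0 : ℝ)..h, Real.exp (-l * t) • T (max t 0) f =
      ∫ t in (0 : ℝ)..h, Real.exp (-l * t) • T t f := by
    refine intervalIntegral.integral_congr fun t ht => ?_
    rw [uIcc_of_le hh] at ht
    simp only [max_eq_left ht.1]
  have hi := hT.integrableOn_laplace hC hl f
  have h2 := intervalIntegral.integral_interval_add_Ioi hi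
    (hi.mono_set (Ioi_subset_Ioi hh))
  rw [h1, laplaceTransform, laplaceTransform, ← h2, add_sub_cancel_left, ← integral_smul,
    ← (measurePreserving_add_right volume h).setIntegral_preimage_emb
      (measurableEmbedding_addRight h) _ (Ioi h), preimage_add_const_Ioi, sub_self]
  refine setIntegral_congr_fun measurableSet_Ioi fun t ht => ?_
  rw [smul_smul, ← Real.exp_add, ← ContinuousLinearMap.comp_apply,
    ← hT.add t h (le_of_lt ht) hh]
  congr 2
  ring

variable [CompleteSpace F]

theorem apply_laplace (hT : IsC0Semigroup T) (hC : ∀ t, 0 ≤ t → ∀ f, ‖T t f‖ ≤ C * ‖f‖)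
    (hl : 0 < l) {h : ℝ} (hh : 0 ≤ h) (f : F) :
    T h (laplaceTransform T l f) = laplaceTransform T l (T h f) := by
  rw [laplaceTransform, laplaceTransform,
    ← (T h).integral_comp_comm (hT.integrableOn_laplace hC hl f)]
  refine setIntegral_congr_fun measurableSet_Ioi fun t ht => ?_
  have ht : 0 < t := ht
  simp only [map_smul]
  rw [← ContinuousLinearMap.comp_apply, ← ContinuousLinearMap.comp_apply, ← hT.add h t hh ht.le,
    ← hT.add t h ht.le hh, add_comm]

/-- The Laplace transform maps into the domain of the generator. -/
theorem hasGeneratorValue_laplace (hT : IsC0Semigroup T)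
    (hC : ∀ t, 0 ≤ t → ∀ f, ‖T t f‖ ≤ C * ‖f‖) (hl : 0 < l) (f : F) :
    HasGeneratorValue T (laplaceTransform T l f) (l • laplaceTransform T l f - f) := by
  have hc : Continuous fun t => Real.exp (-l * t) • T (max t 0) f :=
    (by fun_prop : Continuous fun t => Real.exp (-l * t)).smul (hT.continuous_max f)
  have hd : HasDerivAt (fun h => ∫ t in (0 : ℝ)..h, Real.exp (-l * t) • T (max t 0) f) f 0 := by
    simpa [hT.zero] using intervalIntegral.integral_hasDerivAt_right
      (hc.intervalIntegrable 0 0) (hc.stronglyMeasurableAtFilter _ _) (hc.continuousAt (x := 0))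
  have he : HasDerivAt (fun h => Real.exp (l * h)) l 0 := by
    simpa using ((hasDerivAt_id (0 : ℝ)).const_mul l).exp
  have hφ := he.smul (hd.const_sub (laplaceTransform T l f))
  have hs := hφ.tendsto_slope_zero_right
  simp only [mul_zero, Real.exp_zero, one_smul, intervalIntegral.integral_same, sub_zero,
    zero_add] at hs
  rw [HasGeneratorValue, sub_eq_neg_add]
  refine hs.congr' ?_
  filter_upwards [self_mem_nhdsWithin] with t ht
  have ht : 0 < t := ht
  simp only [Pi.smul_apply', hT.apply_laplace hC hl ht.le, hT.laplace_apply hC hl ht.le,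
    mul_zero, Real.exp_zero, one_smul, intervalIntegral.integral_same, sub_zero]

/-- On the domain of the generator the Laplace transform inverts `l - A`; the Laplace transform
commutes with difference quotients. -/
theorem laplace_of_hasGeneratorValue (hT : IsC0Semigroup T)
    (hC : ∀ t, 0 ≤ t → ∀ f, ‖T t f‖ ≤ C * ‖f‖) (hl : 0 < l) {f g : F}
    (hfg : HasGeneratorValue T f g) : laplaceTransform T l (l • f - g) = f := by
  obtain ⟨R, hR⟩ := hT.exists_laplace_clm hC hl
  have h1 : Tendsto (fun t : ℝ => t⁻¹ • (T t (R f) - R f)) (𝓝[>] 0) (𝓝 (R g)) := by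
    refine ((R.continuous.tendsto g).comp hfg).congr' ?_
    filter_upwards [self_mem_nhdsWithin] with t ht
    rw [Function.comp_apply, map_smul, map_sub, hR, hR, hT.apply_laplace hC hl (le_of_lt ht)]
  have h2 := hT.hasGeneratorValue_laplace hC hl f
  rw [← hR] at h2
  have h3 : R g = l • R f - f := tendsto_nhds_unique h1 h2
  rw [← hR, map_sub, map_smul, h3, sub_sub_cancel]

end IsC0Semigroup

end LaplaceTransform

/-! ### Bochner integrals of `L¹`-valued functions -/

section PointwiseIntegral

variable {E : Type*} [NormedAddCommGroup E] [NormedSpace ℝ E] [CompleteSpace E]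
  {α β : Type*} [MeasurableSpace α] [MeasurableSpace β] {μ : Measure α} {ν : Measure β}

/-- The Bochner integral of an `L¹`-valued function is the pointwise integral. Both sides have the
same integral over every measurable set. -/
theorem coeFn_integral_L1_ae_eq [SFinite μ] [SFinite ν] {Φ : β → Lp E 1 μ} {φ : β → α → E}
    (hΦ : Integrable Φ ν) (hφm : AEStronglyMeasurable (Function.uncurry φ) (ν.prod μ))
    (h : ∀ᵐ t ∂ν, Φ t =ᵐ[μ] φ t) :
    (∫ t, Φ t ∂ν : Lp E 1 μ) =ᵐ[μ] fun s => ∫ t, φ t s ∂ν := by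
  have hφ : Integrable (Function.uncurry φ) (ν.prod μ) := by
    refine (integrable_prod_iff hφm).2 ⟨?_, hΦ.norm.congr ?_⟩
    · filter_upwards [h] with t ht using (L1.integrable_coeFn (Φ t)).congr ht
    · filter_upwards [h] with t ht
      rw [L1.norm_eq_integral_norm]
      exact integral_congr_ae (ht.fun_comp norm)
  refine Integrable.ae_eq_of_forall_setIntegral_eq _ _ (L1.integrable_coeFn _)
    hφ.integral_prod_right fun A hA _ => ?_
  let L : Lp E 1 μ →L[ℝ] E := L1.integralCLM.comp (LpToLpRestrictCLM α E ℝ μ 1 A)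
  have hL : ∀ f : Lp E 1 μ, L f = ∫ s in A, f s ∂μ := fun f => by
    change L1.integralCLM (LpToLpRestrictCLM α E ℝ μ 1 A f) = _
    rw [← L1.integral_eq, L1.integral_eq_integral]
    exact integral_congr_ae (LpToLpRestrictCLM_coeFn ℝ A f)
  rw [← hL, ← L.integral_comp_comm hΦ]
  have hφA : Integrable (Function.uncurry φ) (ν.prod (μ.restrict A)) := by
    rw [← Measure.restrict_univ (μ := ν), Measure.prod_restrict]
    exact hφ.restrict
  rw [← integral_integral_swap hφA]
  refine integral_congr_ae ?_
  filter_upwards [h] with t ht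
  rw [hL]
  exact integral_congr_ae (ae_restrict_of_ae ht)

end PointwiseIntegral

/-! ### The resolvents of evolution semigroups and the operators `𝔅_l` -/

section Resolvent

variable {E : Type*} [NormedAddCommGroup E] [NormedSpace ℝ E]

theorem measurableSet_evolutionIndex : MeasurableSet evolutionIndex :=
  (measurableSet_le measurable_const measurable_snd).inter
    (measurableSet_le measurable_snd measurable_fst)

/-- The resolvent of an evolution semigroup is given by a Volterra integral. -/
theorem IsMeasurableEvolution.laplaceTransform_ae_eq [CompleteSpace E] {W : ℝ → ℝ → E → E} {M : ℝ}
    (hW : IsMeasurableEvolution W M) {l : ℝ} (hl : 0 < l) (k : LiftedSpace E) :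
    (laplaceTransform (evolutionSemigroup W) l k : LiftedSpace E) =ᵐ[halfLineMeasure]
      fun s => ∫ τ in (0 : ℝ)..s, Real.exp (-l * (s - τ)) • W s τ (k τ) := by
  have hΦ := hW.isC0Semigroup.integrableOn_laplace
    (fun t ht => hW.norm_evolutionSemigroup_le ht) hl k
  have hm : AEStronglyMeasurable (Function.uncurry fun t s =>
      Real.exp (-l * t) • evolutionFormula W t k s)
      ((volume.restrict (Ioi 0)).prod halfLineMeasure) := by
    have hexp : Continuous fun p : ℝ × ℝ => Real.exp (-l * p.1) := by fun_prop
    refine hexp.aestronglyMeasurable.smul ?_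
    have hle : MeasurableSet {p : ℝ × ℝ | p.1 ≤ p.2} :=
      measurableSet_le measurable_fst measurable_snd
    have heq : (fun p : ℝ × ℝ => evolutionFormula W p.1 k p.2) =
        {p : ℝ × ℝ | p.1 ≤ p.2}.indicator fun p => W p.2 (p.2 - p.1) (k (p.2 - p.1)) := by
      ext p
      by_cases hp : p.1 ≤ p.2 <;> simp [evolutionFormula, hp]
    rw [heq, aestronglyMeasurable_indicator_iff hle]
    refine hW.measurable (ℝ × ℝ) _ Prod.snd (fun p => p.2 - p.1) (fun p => k (p.2 - p.1))
      measurable_snd.aemeasurable (measurable_snd.sub measurable_fst).aemeasurable ?_ ?_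
    · have h0 : ∀ᵐ p ∂((volume.restrict (Ioi 0)).prod halfLineMeasure : Measure (ℝ × ℝ)),
          0 < p.1 :=
        Measure.quasiMeasurePreserving_fst.ae (ae_restrict_mem measurableSet_Ioi)
      filter_upwards [ae_restrict_of_ae h0, ae_restrict_mem hle] with p hp hp'
      exact ⟨sub_nonneg.2 hp', sub_le_self _ hp.le⟩
    · exact ((Lp.stronglyMeasurable k).comp_measurable
        (measurable_snd.sub measurable_fst)).aestronglyMeasurable
  have hsf : SFinite halfLineMeasure := by
    unfold halfLineMeasure
    infer_instance
  have h := coeFn_integral_L1_ae_eq hΦ hm (by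
    filter_upwards [ae_restrict_mem measurableSet_Ioi] with t ht
    filter_upwards [Lp.coeFn_smul (Real.exp (-l * t)) (evolutionSemigroup W t k),
      hW.isGivenBy (le_of_lt ht) k] with s h1 h2
    rw [h1, Pi.smul_apply, h2])
  filter_upwards [h, ae_restrict_mem measurableSet_Ici] with s hs hs0
  have hs0 : 0 ≤ s := hs0
  refine hs.trans ?_
  have h1 := intervalIntegral.integral_comp_sub_left (a := 0) (b := s)
    (fun τ => Real.exp (-l * (s - τ)) • W s τ (k τ)) s
  rw [sub_self, sub_zero] at h1
  rw [← h1, intervalIntegral.integral_of_le hs0]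
  have h2 : Ioc 0 s = Ioi 0 ∩ Iic s := Ioi_inter_Iic.symm
  rw [h2, ← setIntegral_indicator measurableSet_Iic]
  refine setIntegral_congr_fun measurableSet_Ioi fun t _ => ?_
  by_cases hts : t ≤ s
  · rw [indicator_of_mem (show t ∈ Iic s from hts)]
    simp only [evolutionFormula, if_pos hts, sub_sub_cancel]
  · rw [indicator_of_notMem (show t ∉ Iic s from hts)]
    simp only [evolutionFormula, if_neg hts, smul_zero]

/-- The kernel `(s, τ) ↦ B(s)U(s,τ)f(τ)` on `{0 ≤ τ ≤ s}`, extended by zero to the plane. -/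
noncomputable def perturbationKernel (U : ℝ → ℝ → E →L[ℝ] E) (B : ℝ → E →ₗ.[ℝ] E)
    (f : LiftedSpace E) : ℝ × ℝ → E :=
  evolutionIndex.indicator fun p => (B p.1).val (U p.1 p.2 (f p.2))

variable {U : ℝ → ℝ → E →L[ℝ] E} {B : ℝ → E →ₗ.[ℝ] E}

theorem perturbationKernel_of_mem (f : LiftedSpace E) {s τ : ℝ} (h0 : 0 ≤ τ) (h : τ ≤ s) :
    perturbationKernel U B f (s, τ) = (B s).val (U s τ (f τ)) :=
  indicator_of_mem (show (s, τ) ∈ evolutionIndex from ⟨h0, h⟩) _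

theorem perturbationKernel_of_notMem (f : LiftedSpace E) {p : ℝ × ℝ} (h : p ∉ evolutionIndex) :
    perturbationKernel U B f p = 0 :=
  indicator_of_notMem h _

theorem IsJointlyMeasurable.aestronglyMeasurable_kernel (hm : IsJointlyMeasurable U B)
    (f : LiftedSpace E) :
    AEStronglyMeasurable (perturbationKernel U B f) (volume.prod volume) :=
  (aestronglyMeasurable_indicator_iff measurableSet_evolutionIndex).2 (hm f).2

theorem norm_exp_smul_kernel_le {l : ℝ} (hl : 0 ≤ l) (f : LiftedSpace E) (p : ℝ × ℝ) :
    ‖Real.exp (-l * (p.1 - p.2)) • perturbationKernel U B f p‖ ≤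
      ‖perturbationKernel U B f p‖ := by
  by_cases hp : p ∈ evolutionIndex
  · rw [norm_smul, Real.norm_of_nonneg (Real.exp_pos _).le]
    refine mul_le_of_le_one_left (norm_nonneg _) (Real.exp_le_one_iff.2 ?_)
    have := mul_nonneg hl (sub_nonneg.2 hp.2)
    linarith
  · rw [perturbationKernel_of_notMem f hp, smul_zero]

theorem aestronglyMeasurable_exp_smul_kernel (hm : IsJointlyMeasurable U B) (l : ℝ)
    (f : LiftedSpace E) : AEStronglyMeasurable
      (fun p : ℝ × ℝ => Real.exp (-l * (p.1 - p.2)) • perturbationKernel U B f p)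
      (volume.prod volume) := by
  have hexp : Continuous fun p : ℝ × ℝ => Real.exp (-l * (p.1 - p.2)) := by fun_prop
  exact hexp.aestronglyMeasurable.smul (hm.aestronglyMeasurable_kernel f)

theorem resolventFormula_eq_integral_kernel (l : ℝ) (f : LiftedSpace E) {s : ℝ} (hs : 0 ≤ s) :
    resolventFormula U B l f s =
      ∫ τ, Real.exp (-l * (s - τ)) • perturbationKernel U B f (s, τ) := by
  rw [resolventFormula, intervalIntegral.integral_of_le hs, ← integral_Icc_eq_integral_Ioc,
    ← integral_indicator measurableSet_Icc]
  refine integral_congr_ae (Eventually.of_forall fun τ => ?_)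
  by_cases hτ : τ ∈ Icc 0 s
  · simp only [indicator_of_mem hτ, perturbationKernel_of_mem f hτ.1 hτ.2]
  · simp only [indicator_of_notMem hτ]
    rw [perturbationKernel_of_notMem f fun hp => hτ hp, smul_zero]

theorem kernel_add (hm : IsJointlyMeasurable U B) (f g : LiftedSpace E) :
    ∀ᵐ p ∂(volume.prod volume : Measure (ℝ × ℝ)), perturbationKernel U B (f + g) p =
      perturbationKernel U B f p + perturbationKernel U B g p := by
  have h1 : ∀ᵐ p ∂(volume.prod volume : Measure (ℝ × ℝ)), 0 ≤ p.2 → (f + g) p.2 = f p.2 + g p.2 :=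
    Measure.quasiMeasurePreserving_snd.ae (ae_halfLine_iff.1 (Lp.coeFn_add f g))
  filter_upwards [h1, (ae_restrict_iff' measurableSet_evolutionIndex).1 (hm f).1,
    (ae_restrict_iff' measurableSet_evolutionIndex).1 (hm g).1] with p h1 h2 h3
  by_cases hp : p ∈ evolutionIndex
  · simp only [perturbationKernel, indicator_of_mem hp]
    rw [h1 hp.1, map_add, LinearPMap.val_add _ (h2 hp) (h3 hp)]
  · simp only [perturbationKernel, indicator_of_notMem hp, add_zero]

theorem kernel_smul (hm : IsJointlyMeasurable U B) (c : ℝ) (f : LiftedSpace E) :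
    ∀ᵐ p ∂(volume.prod volume : Measure (ℝ × ℝ)), perturbationKernel U B (c • f) p =
      c • perturbationKernel U B f p := by
  have h1 : ∀ᵐ p ∂(volume.prod volume : Measure (ℝ × ℝ)), 0 ≤ p.2 → (c • f) p.2 = c • f p.2 :=
    Measure.quasiMeasurePreserving_snd.ae (ae_halfLine_iff.1 (Lp.coeFn_smul c f))
  filter_upwards [h1, (ae_restrict_iff' measurableSet_evolutionIndex).1 (hm f).1] with p h1 h2
  by_cases hp : p ∈ evolutionIndex
  · simp only [perturbationKernel, indicator_of_mem hp]
    rw [h1 hp.1, map_smul, LinearPMap.val_smul _ _ (h2 hp)]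
  · simp only [perturbationKernel, indicator_of_notMem hp, smul_zero]

theorem lintegral_resolventFormula_le (hm : IsJointlyMeasurable U B) (l : ℝ)
    (f : LiftedSpace E) :
    ∫⁻ s, ‖resolventFormula U B l f s‖ₑ ∂halfLineMeasure ≤
      ∫⁻ p, ‖Real.exp (-l * (p.1 - p.2)) • perturbationKernel U B f p‖ₑ
        ∂(volume.prod volume) := by
  rw [lintegral_prod _ (aestronglyMeasurable_exp_smul_kernel hm l f).enorm]
  refine le_trans ?_ (lintegral_mono' (Measure.restrict_le_self (s := Ici 0)) le_rfl)
  refine setLIntegral_mono' measurableSet_Ici fun s hs => ?_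
  rw [resolventFormula_eq_integral_kernel l f hs]
  exact enorm_integral_le_lintegral_enorm _

variable [PartialOrder E] {M : ℝ}

/-- Integrating first over `s` for fixed `τ`, the bound on `∫ ‖B(s)U(s,τ)u‖ ds` applies. -/
theorem lintegral_kernel_le (h : IsPerturbedFamily U B) (hm : IsJointlyMeasurable U B)
    (hM : HasDecomposition E M) (f : LiftedSpace E) :
    ∫⁻ p, ‖perturbationKernel U B f p‖ₑ ∂(volume.prod volume) ≤
      ENNReal.ofReal M * ∫⁻ s, ‖f s‖ₑ ∂halfLineMeasure := by
  rw [lintegral_prod_symm _ (hm.aestronglyMeasurable_kernel f).enorm,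
    ← lintegral_const_mul' _ _ ENNReal.ofReal_ne_top]
  refine le_trans ?_ (lintegral_indicator measurableSet_Ici _).le
  refine lintegral_mono fun τ => ?_
  by_cases hτ : 0 ≤ τ
  · rw [indicator_of_mem (show τ ∈ Ici 0 from hτ), ← ofReal_norm (f τ),
      ← ENNReal.ofReal_mul hM.1]
    refine le_trans (le_of_eq ?_) (h.lintegral_Ici_le hM hτ (f τ))
    rw [← lintegral_indicator measurableSet_Ici]
    refine lintegral_congr fun s => ?_
    by_cases hs : τ ≤ s
    · rw [indicator_of_mem (show s ∈ Ici τ from hs), perturbationKernel_of_mem f hτ hs]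
    · rw [indicator_of_notMem (show s ∉ Ici τ from hs),
        perturbationKernel_of_notMem f fun hp => hs hp.2, enorm_zero]
  · rw [indicator_of_notMem (show τ ∉ Ici 0 from hτ), nonpos_iff_eq_zero]
    refine (lintegral_congr fun s => ?_).trans lintegral_zero
    rw [perturbationKernel_of_notMem f fun hp => hτ hp.1, enorm_zero]

theorem integrable_kernel (h : IsPerturbedFamily U B) (hm : IsJointlyMeasurable U B)
    (hM : HasDecomposition E M) (f : LiftedSpace E) :
    Integrable (perturbationKernel U B f) (volume.prod volume) :=
  ⟨hm.aestronglyMeasurable_kernel f, (lintegral_kernel_le h hm hM f).trans_lt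
    (ENNReal.mul_lt_top ENNReal.ofReal_lt_top (L1.integrable_coeFn f).hasFiniteIntegral)⟩

theorem integrable_exp_smul_kernel (h : IsPerturbedFamily U B) (hm : IsJointlyMeasurable U B)
    (hM : HasDecomposition E M) {l : ℝ} (hl : 0 ≤ l) (f : LiftedSpace E) :
    Integrable (fun p : ℝ × ℝ => Real.exp (-l * (p.1 - p.2)) • perturbationKernel U B f p)
      (volume.prod volume) :=
  (integrable_kernel h hm hM f).mono (aestronglyMeasurable_exp_smul_kernel hm l f)
    (Eventually.of_forall (norm_exp_smul_kernel_le hl f))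

theorem intervalIntegrable_resolventFormula (h : IsPerturbedFamily U B)
    (hm : IsJointlyMeasurable U B) (hM : HasDecomposition E M) {l : ℝ} (hl : 0 ≤ l)
    (f : LiftedSpace E) : ∀ᵐ s ∂halfLineMeasure, IntervalIntegrable
      (fun τ => Real.exp (-l * (s - τ)) • (B s).val (U s τ (f τ))) volume 0 s := by
  filter_upwards [ae_restrict_of_ae (integrable_exp_smul_kernel h hm hM hl f).prod_right_ae,
    ae_restrict_mem measurableSet_Ici] with s hs hs0
  rw [intervalIntegrable_iff_integrableOn_Icc_of_le hs0]
  refine (hs.integrableOn (s := Icc 0 s)).congr_fun (fun τ hτ => ?_) measurableSet_Icc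
  simp only [perturbationKernel_of_mem f hτ.1 hτ.2]

theorem resolventPerturbation_isGivenBy (h : IsPerturbedFamily U B)
    (hm : IsJointlyMeasurable U B) (hM : HasDecomposition E M) {l : ℝ} (hl : 0 ≤ l) :
    IsGivenBy (resolventPerturbation U B l) (resolventFormula U B l) := by
  have hG := integrable_exp_smul_kernel h hm hM hl
  refine operatorOf_isGivenBy (exists_isGivenBy hM.1 (fun f => ?_) (fun f g => ?_)
    (fun c f => ?_) fun f => ?_)
  · refine (hG f).integral_prod_left.aestronglyMeasurable.restrict.congr ?_
    filter_upwards [ae_restrict_mem measurableSet_Ici] with s hs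
    exact (resolventFormula_eq_integral_kernel l f hs).symm
  · filter_upwards [ae_restrict_mem measurableSet_Ici, ae_restrict_of_ae (hG f).prod_right_ae,
      ae_restrict_of_ae (hG g).prod_right_ae,
      ae_restrict_of_ae (Measure.ae_ae_of_ae_prod (kernel_add hm f g))] with s hs h1 h2 h3
    rw [resolventFormula_eq_integral_kernel l _ hs, resolventFormula_eq_integral_kernel l _ hs,
      resolventFormula_eq_integral_kernel l _ hs, ← integral_add h1 h2]
    refine integral_congr_ae ?_
    filter_upwards [h3] with τ hτ
    rw [hτ, smul_add]
  · filter_upwards [ae_restrict_mem measurableSet_Ici,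
      ae_restrict_of_ae (Measure.ae_ae_of_ae_prod (kernel_smul hm c f))] with s hs h3
    rw [resolventFormula_eq_integral_kernel l _ hs, resolventFormula_eq_integral_kernel l _ hs,
      ← integral_smul]
    refine integral_congr_ae ?_
    filter_upwards [h3] with τ hτ
    rw [hτ, smul_comm]
  · refine (lintegral_resolventFormula_le hm l f).trans (le_trans ?_
      (lintegral_kernel_le h hm hM f))
    exact lintegral_mono fun p => enorm_le_iff_norm_le.2 (norm_exp_smul_kernel_le hl f p)

/-- The operators `𝔅_l` tend strongly to `0`: `exp(-l (s - τ))` tends to `0` off the diagonal, and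
the kernel is integrable. -/
theorem tendsto_resolventPerturbation (h : IsPerturbedFamily U B)
    (hm : IsJointlyMeasurable U B) (hM : HasDecomposition E M) (f : LiftedSpace E) :
    Tendsto (fun l => resolventPerturbation U B l f) atTop (𝓝 0) := by
  have hK := integrable_kernel h hm hM f
  have hlim : Tendsto (fun l : ℝ => ∫ p : ℝ × ℝ,
      ‖Real.exp (-l * (p.1 - p.2)) • perturbationKernel U B f p‖ ∂(volume.prod volume)) atTop
      (𝓝 (∫ _ : ℝ × ℝ, (0 : ℝ) ∂(volume.prod volume))) := by
    refine tendsto_integral_filter_of_dominated_convergence _ ?_ ?_ hK.norm ?_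
    · exact Eventually.of_forall fun l => (aestronglyMeasurable_exp_smul_kernel hm l f).norm
    · filter_upwards [eventually_ge_atTop 0] with l hl
      refine Eventually.of_forall fun p => ?_
      rw [norm_norm]
      exact norm_exp_smul_kernel_le hl f p
    · have hdiag : ∀ᵐ p ∂(volume.prod volume : Measure (ℝ × ℝ)), p.1 ≠ p.2 := by
        have hms : MeasurableSet {p : ℝ × ℝ | p.1 = p.2} :=
          measurableSet_eq_fun measurable_fst measurable_snd
        refine measure_eq_zero_iff_ae_notMem.1 ((Measure.measure_prod_null hms).2 ?_)
        refine Eventually.of_forall fun s => ?_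
        have : Prod.mk s ⁻¹' {p : ℝ × ℝ | p.1 = p.2} = {s} := by
          ext τ
          simp [eq_comm]
        simp only [this, Real.volume_singleton, Pi.zero_apply]
      filter_upwards [hdiag] with p hp
      by_cases hpm : p ∈ evolutionIndex
      · have hpos : 0 < p.1 - p.2 := sub_pos.2 (lt_of_le_of_ne hpm.2 (Ne.symm hp))
        have h1 : Tendsto (fun l : ℝ => Real.exp (-l * (p.1 - p.2))) atTop (𝓝 0) :=
          Real.tendsto_exp_atBot.comp (tendsto_neg_atTop_atBot.atBot_mul_const hpos)
        simpa using (h1.smul_const (perturbationKernel U B f p)).norm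
      · simp [perturbationKernel_of_notMem f hpm]
  rw [integral_zero] at hlim
  refine squeeze_zero_norm' ?_ hlim
  filter_upwards [eventually_ge_atTop 0] with l hl
  have hG := integrable_exp_smul_kernel h hm hM hl f
  rw [L1.norm_def, integral_norm_eq_lintegral_enorm hG.aestronglyMeasurable,
    lintegral_congr_ae (f := fun s => ‖resolventPerturbation U B l f s‖ₑ)
      (g := fun s => ‖resolventFormula U B l f s‖ₑ)
      ((resolventPerturbation_isGivenBy h hm hM hl f).fun_comp enorm)]
  exact ENNReal.toReal_mono hG.hasFiniteIntegral.ne (lintegral_resolventFormula_le hm l f)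

end Resolvent

/-! ### Generators and Duhamel's formula for semigroups -/

section GeneratorTools

variable {F : Type*} [NormedAddCommGroup F] [NormedSpace ℝ F] {T T₀ : ℝ → F →L[ℝ] F} {C : ℝ}

theorem HasGeneratorValue.mem_domain {f g : F} (h : HasGeneratorValue T f g) :
    f ∈ (generator T).domain :=
  ⟨g, h⟩

theorem HasGeneratorValue.val_eq {f g : F} (h : HasGeneratorValue T f g) :
    (generator T).val f = g := by
  rw [LinearPMap.val_of_mem _ h.mem_domain]
  exact tendsto_nhds_unique (generator_spec T ⟨f, h.mem_domain⟩) h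

theorem hasGeneratorValue_val {f : F} (h : f ∈ (generator T).domain) :
    HasGeneratorValue T f ((generator T).val f) := by
  rw [LinearPMap.val_of_mem _ h]
  exact generator_spec T ⟨f, h⟩

namespace IsC0Semigroup

/-- A semigroup leaves the domain of its generator invariant and commutes with it. -/
theorem hasGeneratorValue_apply (hT : IsC0Semigroup T) {f g : F} (h : HasGeneratorValue T f g)
    {s : ℝ} (hs : 0 ≤ s) : HasGeneratorValue T (T s f) (T s g) := by
  refine (((T s).continuous.tendsto g).comp h).congr' ?_
  filter_upwards [self_mem_nhdsWithin] with t ht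
  rw [Function.comp_apply, map_smul, map_sub, ← ContinuousLinearMap.comp_apply,
    ← ContinuousLinearMap.comp_apply, ← hT.add s t hs (le_of_lt ht),
    ← hT.add t s (le_of_lt ht) hs, add_comm]

/-- A bounded strongly continuous semigroup is jointly continuous. -/
theorem tendsto_apply (hT : IsC0Semigroup T) (hC : ∀ t, 0 ≤ t → ∀ f, ‖T t f‖ ≤ C * ‖f‖)
    {ι : Type*} {φ : Filter ι} {a : ι → ℝ} {x : ι → F} {a₀ : ℝ} {x₀ : F} (ha₀ : 0 ≤ a₀)
    (ha : Tendsto a φ (𝓝[Ici 0] a₀)) (hx : Tendsto x φ (𝓝 x₀)) :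
    Tendsto (fun i => T (a i) (x i)) φ (𝓝 (T a₀ x₀)) := by
  have h1 : Tendsto (fun i => T (a i) (x i - x₀)) φ (𝓝 0) := by
    have h2 := ((hx.sub_const x₀).norm).const_mul C
    rw [sub_self, norm_zero, mul_zero] at h2
    refine squeeze_zero_norm' ?_ h2
    filter_upwards [(tendsto_nhdsWithin_iff.1 ha).2] with i hi using hC _ hi _
  have h3 := h1.add ((hT.continuousOn x₀ a₀ ha₀).tendsto.comp ha)
  rw [zero_add] at h3
  refine h3.congr fun i => ?_
  rw [Function.comp_apply, ← map_add, sub_add_cancel]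

/-- Duhamel's formula for two semigroups whose generators differ by `w s` at `T₀(s)f`: the right
derivative of `s ↦ T(t - s) T₀(s)f` is `-T(t - s) w(s)`. -/
theorem duhamel [CompleteSpace F] (hT₀ : IsC0Semigroup T₀) (hT : IsC0Semigroup T)
    (hC : ∀ t, 0 ≤ t → ∀ f, ‖T t f‖ ≤ C * ‖f‖) {f : F} {w : ℝ → F}
    (hw : ContinuousOn w (Ici 0)) (hgen : ∀ s, 0 ≤ s → ∃ z,
      HasGeneratorValue T₀ (T₀ s f) z ∧ HasGeneratorValue T (T₀ s f) (z + w s))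
    {t : ℝ} (ht : 0 ≤ t) :
    IntervalIntegrable (fun s => T (t - s) (w s)) volume 0 t ∧
      T t f = T₀ t f + ∫ s in (0 : ℝ)..t, T (t - s) (w s) := by
  have hcont : ∀ x : ℝ → F, ContinuousOn x (Ici 0) →
      ContinuousOn (fun s => T (t - s) (x s)) (uIcc 0 t) := by
    intro x hx s hs
    rw [uIcc_of_le ht] at hs ⊢
    refine hT.tendsto_apply hC (sub_nonneg.2 hs.2) (tendsto_nhdsWithin_iff.2 ⟨?_, ?_⟩)
      ((hx s hs.1).mono Icc_subset_Ici_self)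
    · have : Continuous fun s : ℝ => t - s := by fun_prop
      exact (this.tendsto s).mono_left nhdsWithin_le_nhds
    · filter_upwards [self_mem_nhdsWithin] with r hr using sub_nonneg.2 hr.2
  have hi : IntervalIntegrable (fun s => T (t - s) (w s)) volume 0 t :=
    (hcont w hw).intervalIntegrable
  refine ⟨hi, ?_⟩
  have hderiv : ∀ s ∈ Ioo (min 0 t) (max 0 t), HasDerivWithinAt
      (fun s => T (t - s) (T₀ s f)) (-T (t - s) (w s)) (Ioi s) s := by
    intro s hs
    rw [min_eq_left ht, max_eq_right ht] at hs
    obtain ⟨z, hz₀, hz⟩ := hgen s hs.1.le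
    rw [hasDerivWithinAt_iff_tendsto_slope' self_notMem_Ioi]
    have hshift : Tendsto (fun y : ℝ => y - s) (𝓝[>] s) (𝓝[>] 0) := by
      refine tendsto_nhdsWithin_iff.2 ⟨?_, ?_⟩
      · have : Continuous fun y : ℝ => y - s := by fun_prop
        simpa using (this.tendsto s).mono_left nhdsWithin_le_nhds
      · filter_upwards [self_mem_nhdsWithin] with y hy using mem_Ioi.2 (sub_pos.2 (mem_Ioi.1 hy))
    have hev : ∀ᶠ y in 𝓝[>] s, s < y ∧ y < t := by
      filter_upwards [self_mem_nhdsWithin, mem_nhdsWithin_of_mem_nhds (Iio_mem_nhds hs.2)]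
        with y h1 h2 using ⟨h1, h2⟩
    have hrev : Tendsto (fun y : ℝ => t - y) (𝓝[>] s) (𝓝[Ici 0] (t - s)) := by
      refine tendsto_nhdsWithin_iff.2 ⟨?_, ?_⟩
      · have : Continuous fun y : ℝ => t - y := by fun_prop
        exact (this.tendsto s).mono_left nhdsWithin_le_nhds
      · filter_upwards [hev] with y hy using sub_nonneg.2 hy.2.le
    have hlim := hT.tendsto_apply hC (sub_nonneg.2 hs.2.le) hrev
      ((Tendsto.comp hz₀ hshift).sub (Tendsto.comp hz hshift))
    rw [sub_add_cancel_left, map_neg] at hlim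
    refine hlim.congr' ?_
    filter_upwards [hev] with y hy
    have hys : 0 ≤ y - s := sub_nonneg.2 hy.1.le
    have hty : 0 ≤ t - y := sub_nonneg.2 hy.2.le
    have h1 : T₀ y f = T₀ (y - s) (T₀ s f) := by
      rw [← ContinuousLinearMap.comp_apply, ← hT₀.add _ _ hys hs.1.le, sub_add_cancel]
    have h2 : T (t - s) (T₀ s f) = T (t - y) (T (y - s) (T₀ s f)) := by
      rw [← ContinuousLinearMap.comp_apply (T (t - y)), ← hT.add _ _ hty hys,
        sub_add_sub_cancel]
    rw [slope_def_module, h1, h2, Function.comp_apply, Function.comp_apply, ← smul_sub,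
      sub_sub_sub_cancel_right, map_smul, map_sub]
  have h := intervalIntegral.integral_eq_sub_of_hasDeriv_right
    (hcont (fun s => T₀ s f) (hT₀.continuousOn f)) hderiv hi.neg
  rw [intervalIntegral.integral_neg, sub_self, sub_zero, hT.zero, hT₀.zero] at h
  simp only [ContinuousLinearMap.id_apply] at h
  rw [neg_eq_iff_eq_neg.1 h]
  abel

end IsC0Semigroup

end GeneratorTools

/-! ### The resolvent identity and the perturbed generator -/

section Perturbation

variable {E : Type*} [NormedAddCommGroup E] [NormedSpace ℝ E]

theorem IsMeasurableEvolution.intervalIntegrable_volterra {W : ℝ → ℝ → E → E} {M : ℝ}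
    (hW : IsMeasurableEvolution W M) {l : ℝ} (hl : 0 ≤ l) (k : LiftedSpace E) {s : ℝ}
    (hs : 0 ≤ s) :
    IntervalIntegrable (fun τ => Real.exp (-l * (s - τ)) • W s τ (k τ)) volume 0 s := by
  rw [intervalIntegrable_iff_integrableOn_Icc_of_le hs]
  have hk : IntegrableOn k (Icc 0 s) := (L1.integrable_coeFn k).mono_measure
    (Measure.restrict_mono Icc_subset_Ici_self le_rfl)
  have hexp : Continuous fun τ => Real.exp (-l * (s - τ)) := by fun_prop
  refine Integrable.mono' (hk.norm.const_mul M) (hexp.aestronglyMeasurable.smul ?_) ?_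
  · refine hW.measurable ℝ _ (fun _ => s) id k aemeasurable_const aemeasurable_id ?_
      hk.aestronglyMeasurable
    filter_upwards [ae_restrict_mem measurableSet_Icc] with τ hτ using hτ
  · filter_upwards [ae_restrict_mem measurableSet_Icc] with τ hτ
    rw [norm_smul, Real.norm_of_nonneg (Real.exp_pos _).le]
    have h1 : Real.exp (-l * (s - τ)) ≤ 1 := by
      rw [Real.exp_le_one_iff]
      have := mul_nonneg hl (sub_nonneg.2 hτ.2)
      linarith
    exact (mul_le_of_le_one_left (norm_nonneg _) h1).trans (hW.norm_le s τ hτ.1 hτ.2 _)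

variable [PartialOrder E] {M : ℝ} {U : ℝ → ℝ → E →L[ℝ] E} {B : ℝ → E →ₗ.[ℝ] E}

theorem IsPerturbedFamily.isMeasurableEvolution (h : IsPerturbedFamily U B)
    (hM : HasDecomposition E M) : IsMeasurableEvolution (fun t s u => U t s u) M where
  add _ _ _ _ := map_add _
  smul _ _ _ _ := map_smul _
  bound_nonneg := hM.1
  norm_le _ _ hs hst := h.norm_le_mul hM hs hst
  refl t ht u := by rw [h.evolution.refl t ht, ContinuousLinearMap.id_apply]
  comp t r s hs hsr hrt u := by
    rw [h.evolution.comp t r s hs hsr hrt, ContinuousLinearMap.comp_apply]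
  measurable := h.isSubstochasticFamily.isMeasurableFamily hM
  diagonal s hs u := by
    have := (h.evolution.continuousOn u (s, s) ⟨hs, le_rfl⟩).tendsto
    simpa only [h.evolution.refl s hs, ContinuousLinearMap.id_apply] using this

variable [IsOrderedAddMonoid E] [IsOrderedModule ℝ E] [OrderClosedTopology E] [CompleteSpace E]

theorem IsPerturbedFamily.perturbedFamily_isMeasurableEvolution (h : IsPerturbedFamily U B)
    (hM : HasDecomposition E M) : IsMeasurableEvolution (perturbedFamily U B) M where
  add _ _ hs hst := h.perturbedFamily_add hM hs hst
  smul _ _ hs hst := h.perturbedFamily_smul hM hs hst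
  bound_nonneg := hM.1
  norm_le _ _ hs hst := h.norm_perturbedFamily_le hM hs hst
  refl _ ht := h.perturbedFamily_refl hM ht
  comp _ _ _ hs hsr hrt := h.perturbedFamily_comp hM hs hsr hrt
  measurable := h.perturbedFamily_isMeasurableFamily hM
  diagonal _ hs := h.tendsto_perturbedFamily_diagonal hM hs

/-- The pointwise form of the resolvent identity: Duhamel's formula and Fubini's theorem on the
triangle `0 ≤ τ ≤ r ≤ s`. -/
theorem volterra_resolventPerturbation (h : IsPerturbedFamily U B) (hm : IsJointlyMeasurable U B)
    (hM : HasDecomposition E M) {l : ℝ} (hl : 0 ≤ l) (g : LiftedSpace E) {s : ℝ} (hs : 0 ≤ s) :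
    ∫ r in (0 : ℝ)..s, Real.exp (-l * (s - r)) •
        perturbedFamily U B s r (resolventPerturbation U B l g r) =
      ∫ τ in (0 : ℝ)..s, Real.exp (-l * (s - τ)) •
        (perturbedFamily U B s τ (g τ) - U s τ (g τ)) := by
  have hV := h.perturbedFamily_isMeasurableEvolution hM
  have hclm : ∀ r, 0 ≤ r → r ≤ s → ∃ L : E →L[ℝ] E, ∀ u, L u = perturbedFamily U B s r u :=
    fun r hr hrs => ⟨LinearMap.mkContinuous ⟨⟨perturbedFamily U B s r, hV.add s r hr hrs⟩,
      hV.smul s r hr hrs⟩ M (hV.norm_le s r hr hrs), fun _ => rfl⟩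
  set K := perturbationKernel U B g
  have hK := integrable_kernel h hm hM g
  let S : Set (ℝ × ℝ) := evolutionIndex ∩ {p | p.1 ≤ s}
  have hS : MeasurableSet S :=
    measurableSet_evolutionIndex.inter (measurableSet_le measurable_fst measurable_const)
  -- The integrand at `(r, τ)`, cut off to the triangle `0 ≤ τ ≤ r ≤ s`.
  let H : ℝ × ℝ → E := S.indicator fun p =>
    Real.exp (-l * (s - p.2)) • perturbedFamily U B s p.1 (K p)
  have hH : Integrable H (volume.prod volume) := by
    refine Integrable.mono' (hK.norm.const_mul M) ?_ (Eventually.of_forall fun p => ?_)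
    · rw [aestronglyMeasurable_indicator_iff hS]
      have hexp : Continuous fun p : ℝ × ℝ => Real.exp (-l * (s - p.2)) := by fun_prop
      refine hexp.aestronglyMeasurable.smul (hV.measurable (ℝ × ℝ) _ (fun _ => s) Prod.fst K
        aemeasurable_const measurable_fst.aemeasurable ?_ hK.aestronglyMeasurable.restrict)
      filter_upwards [ae_restrict_mem hS] with p hp using ⟨hp.1.1.trans hp.1.2, hp.2⟩
    · by_cases hp : p ∈ S
      · simp only [H, indicator_of_mem hp]
        rw [norm_smul, Real.norm_of_nonneg (Real.exp_pos _).le]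
        have h1 : Real.exp (-l * (s - p.2)) ≤ 1 := by
          rw [Real.exp_le_one_iff]
          have := mul_nonneg hl (sub_nonneg.2 (hp.1.2.trans hp.2))
          linarith
        exact (mul_le_of_le_one_left (norm_nonneg _) h1).trans
          (hV.norm_le s p.1 (hp.1.1.trans hp.1.2) hp.2 _)
      · simp only [H, indicator_of_notMem hp, norm_zero]
        exact mul_nonneg hM.1 (norm_nonneg _)
  have hleft : ∫ r in (0 : ℝ)..s, Real.exp (-l * (s - r)) •
      perturbedFamily U B s r (resolventPerturbation U B l g r) = ∫ r, ∫ τ, H (r, τ) := by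
    rw [intervalIntegral.integral_of_le hs, ← integral_Icc_eq_integral_Ioc,
      ← integral_indicator measurableSet_Icc]
    refine integral_congr_ae ?_
    filter_upwards [ae_halfLine_iff.1 (resolventPerturbation_isGivenBy h hm hM hl g),
      (integrable_exp_smul_kernel h hm hM hl g).prod_right_ae] with r hr hri
    by_cases hrs : r ∈ Icc 0 s
    · obtain ⟨L, hL⟩ := hclm r hrs.1 hrs.2
      simp only [indicator_of_mem hrs]
      rw [hr hrs.1, resolventFormula_eq_integral_kernel l g hrs.1, ← hL,
        ← L.integral_comp_comm hri, ← integral_smul]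
      refine integral_congr_ae (Eventually.of_forall fun τ => ?_)
      by_cases hτ : (r, τ) ∈ evolutionIndex
      · simp only [H, indicator_of_mem (show (r, τ) ∈ S from ⟨hτ, hrs.2⟩)]
        rw [map_smul, smul_smul, ← Real.exp_add, hL]
        congr 2
        ring
      · simp only [H, indicator_of_notMem fun hh : (r, τ) ∈ S => hτ hh.1]
        rw [perturbationKernel_of_notMem g hτ, smul_zero, map_zero, smul_zero]
    · rw [indicator_of_notMem hrs]
      refine (integral_eq_zero_of_ae (Eventually.of_forall fun τ => ?_)).symm
      exact indicator_of_notMem (fun hh : (r, τ) ∈ S => hrs ⟨hh.1.1.trans hh.1.2, hh.2⟩) _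
  have hright : ∫ τ in (0 : ℝ)..s, Real.exp (-l * (s - τ)) •
      (perturbedFamily U B s τ (g τ) - U s τ (g τ)) = ∫ τ, ∫ r, H (r, τ) := by
    rw [intervalIntegral.integral_of_le hs, ← integral_Icc_eq_integral_Ioc,
      ← integral_indicator measurableSet_Icc]
    refine integral_congr_ae (Eventually.of_forall fun τ => ?_)
    by_cases hτ : τ ∈ Icc 0 s
    · simp only [indicator_of_mem hτ]
      rw [h.perturbedFamily_eq_add_integral hM hτ.1 hτ.2, add_sub_cancel_left,
        intervalIntegral.integral_of_le hτ.2, ← integral_Icc_eq_integral_Ioc, ← integral_smul,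
        ← integral_indicator measurableSet_Icc]
      refine integral_congr_ae (Eventually.of_forall fun r => ?_)
      by_cases hr : r ∈ Icc τ s
      · simp only [H, indicator_of_mem hr,
          indicator_of_mem (show (r, τ) ∈ S from ⟨⟨hτ.1, hr.1⟩, hr.2⟩)]
        simp only [K, perturbationKernel_of_mem g hτ.1 hr.1]
      · simp only [H, indicator_of_notMem hr,
          indicator_of_notMem fun hh : (r, τ) ∈ S => hr ⟨hh.1.2, hh.2⟩]
    · rw [indicator_of_notMem hτ]
      refine (integral_eq_zero_of_ae (Eventually.of_forall fun r => ?_)).symm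
      exact indicator_of_notMem (fun hh : (r, τ) ∈ S => hτ ⟨hh.1.1, hh.1.2.trans hh.2⟩) _
  rw [hleft, hright]
  exact integral_integral_swap (f := fun r τ => H (r, τ)) hH

/-- The resolvent identity `R_T = R_{T₀} + R_T 𝔅_l`. -/
theorem laplaceTransform_perturbed (h : IsPerturbedFamily U B) (hm : IsJointlyMeasurable U B)
    (hM : HasDecomposition E M) {l : ℝ} (hl : 0 < l) (g : LiftedSpace E) :
    laplaceTransform (evolutionSemigroup (perturbedFamily U B)) l g =
      laplaceTransform (evolutionSemigroup fun t s u => U t s u) l g +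
        laplaceTransform (evolutionSemigroup (perturbedFamily U B)) l
          (resolventPerturbation U B l g) := by
  have hU := h.isMeasurableEvolution hM
  have hV := h.perturbedFamily_isMeasurableEvolution hM
  refine Lp.ext ?_
  filter_upwards [hV.laplaceTransform_ae_eq hl g, hU.laplaceTransform_ae_eq hl g,
    hV.laplaceTransform_ae_eq hl (resolventPerturbation U B l g),
    Lp.coeFn_add (laplaceTransform (evolutionSemigroup fun t s u => U t s u) l g)
      (laplaceTransform (evolutionSemigroup (perturbedFamily U B)) l
        (resolventPerturbation U B l g)), ae_restrict_mem measurableSet_Ici] with s h1 h2 h3 h4 hs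
  rw [h4, Pi.add_apply, h1, h2, h3, volterra_resolventPerturbation h hm hM hl.le g hs]
  simp only [smul_sub]
  rw [intervalIntegral.integral_sub (hV.intervalIntegrable_volterra hl.le g hs)
    (hU.intervalIntegrable_volterra hl.le g hs), add_sub_cancel]

/-- On the domain of the unperturbed generator `Z` the perturbed generator acts as
`f ↦ Z f + 𝔅_l (l f - Z f)`. -/
theorem hasGeneratorValue_perturbed (h : IsPerturbedFamily U B) (hm : IsJointlyMeasurable U B)
    (hM : HasDecomposition E M) {l : ℝ} (hl : 0 < l) {f z : LiftedSpace E}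
    (hf : HasGeneratorValue (evolutionSemigroup fun t s u => U t s u) f z) :
    HasGeneratorValue (evolutionSemigroup (perturbedFamily U B)) f
      (z + resolventPerturbation U B l (l • f - z)) := by
  have hU := h.isMeasurableEvolution hM
  have hV := h.perturbedFamily_isMeasurableEvolution hM
  have hbU := fun t (ht : (0 : ℝ) ≤ t) => hU.norm_evolutionSemigroup_le ht
  have hbV := fun t (ht : (0 : ℝ) ≤ t) => hV.norm_evolutionSemigroup_le ht
  set g := l • f - z
  have h0 : laplaceTransform (evolutionSemigroup fun t s u => U t s u) l g = f :=
    hU.isC0Semigroup.laplace_of_hasGeneratorValue hbU hl hf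
  obtain ⟨R, hR⟩ := hV.isC0Semigroup.exists_laplace_clm hbV hl
  have h1 := laplaceTransform_perturbed h hm hM hl g
  rw [h0, ← hR, ← hR] at h1
  have h2 : laplaceTransform (evolutionSemigroup (perturbedFamily U B)) l
      (g - resolventPerturbation U B l g) = f := by
    rw [← hR, map_sub, h1, add_sub_cancel_right]
  have h3 := hV.isC0Semigroup.hasGeneratorValue_laplace hbV hl
    (g - resolventPerturbation U B l g)
  rw [h2] at h3
  convert h3 using 1
  simp only [g]
  abel

end Perturbation

/-! ### Positivity -/

section Positivity

variable {E : Type*} [NormedAddCommGroup E] [PartialOrder E]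

/-- Limits in `L¹` are almost everywhere limits along a subsequence. -/
theorem isClosed_liftedCone [OrderClosedTopology E] : IsClosed (liftedCone E) := by
  refine isClosed_of_closure_subset fun f hf => ?_
  obtain ⟨x, hx, hlim⟩ := mem_closure_iff_seq_limit.1 hf
  obtain ⟨φ, -, hφ⟩ := (tendstoInMeasure_of_tendsto_Lp hlim).exists_seq_tendsto_ae
  filter_upwards [hφ, ae_all_iff.2 hx] with s h1 h2
  exact ge_of_tendsto h1 (Eventually.of_forall fun n => h2 (φ n))

variable [NormedSpace ℝ E] {M : ℝ} {U : ℝ → ℝ → E →L[ℝ] E} {B : ℝ → E →ₗ.[ℝ] E}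

theorem IsMeasurableEvolution.evolutionSemigroup_mem_liftedCone {W : ℝ → ℝ → E → E}
    (hW : IsMeasurableEvolution W M)
    (hpos : ∀ t s : ℝ, 0 ≤ s → s ≤ t → ∀ u, 0 ≤ u → 0 ≤ W t s u) {t : ℝ} (ht : 0 ≤ t)
    {f : LiftedSpace E} (hf : f ∈ liftedCone E) : evolutionSemigroup W t f ∈ liftedCone E := by
  filter_upwards [hW.isGivenBy ht f, ae_restrict_of_ae (ae_shift hf t)] with s h1 h2
  rw [h1, evolutionFormula]
  split_ifs with hts
  · exact hpos _ _ (sub_nonneg.2 hts) (sub_le_self _ ht) _ (h2 hts)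
  · exact le_rfl

theorem IsMeasurableEvolution.norm_evolutionSemigroup_le_of_mem {W : ℝ → ℝ → E → E}
    (hW : IsMeasurableEvolution W M)
    (hle : ∀ t s : ℝ, 0 ≤ s → s ≤ t → ∀ u, 0 ≤ u → ‖W t s u‖ ≤ ‖u‖) {t : ℝ} (ht : 0 ≤ t)
    {f : LiftedSpace E} (hf : f ∈ liftedCone E) : ‖evolutionSemigroup W t f‖ ≤ ‖f‖ := by
  rw [← one_mul ‖f‖]
  refine (hW.isGivenBy ht).norm_le zero_le_one (lintegral_evolutionFormula_le_of_ae ht ?_)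
  filter_upwards [hf, ae_restrict_mem measurableSet_Ici] with s hs hs0
  rw [ENNReal.ofReal_one, one_mul]
  exact enorm_le_iff_norm_le.2 (hle _ _ hs0 (le_add_of_nonneg_right ht) _ hs)

variable [IsOrderedAddMonoid E] [IsOrderedModule ℝ E] [OrderClosedTopology E]

theorem resolventPerturbation_mem_liftedCone (h : IsPerturbedFamily U B)
    (hm : IsJointlyMeasurable U B) (hM : HasDecomposition E M) {l : ℝ} (hl : 0 ≤ l)
    {f : LiftedSpace E} (hf : f ∈ liftedCone E) :
    resolventPerturbation U B l f ∈ liftedCone E := by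
  filter_upwards [resolventPerturbation_isGivenBy h hm hM hl f, ae_restrict_mem measurableSet_Ici]
    with s h1 hs
  rw [h1, resolventFormula_eq_integral_kernel l f hs]
  refine integral_nonneg_of_ae ?_
  filter_upwards [ae_halfLine_iff.1 hf] with τ hτ
  refine smul_nonneg (Real.exp_pos _).le (indicator_apply_nonneg fun hp => ?_)
  exact h.val_nonneg (hp.1.trans hp.2) (h.nonneg _ _ hp.1 hp.2 _ (hτ hp.1))

end Positivity

theorem mainTheorem3 {E : Type*} [NormedAddCommGroup E] [NormedSpace ℝ E] [CompleteSpace E]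
    [PartialOrder E] [IsOrderedAddMonoid E] [IsOrderedModule ℝ E] [OrderClosedTopology E]
    (hE : IsAbstractStateSpace E)
    (U : ℝ → ℝ → E →L[ℝ] E) (B : ℝ → E →ₗ.[ℝ] E)
    (hUB : IsPerturbedFamily U B) (hmeas : IsJointlyMeasurable U B)
    (T₀ T : ℝ → LiftedSpace E →L[ℝ] LiftedSpace E)
    (hT₀ : T₀ = evolutionSemigroup (fun t s u => U t s u))
    (hT : T = evolutionSemigroup (perturbedFamily U B))
    (Z G : LiftedSpace E →ₗ.[ℝ] LiftedSpace E)
    (hZ : Z = generator T₀) (hG : G = generator T) :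
    -- the Dyson–Phillips iterates and their sum are given by convergent integrals and series
    (∀ t s : ℝ, 0 ≤ s → s ≤ t → ∀ u : E,
      (∀ n, IntervalIntegrable (fun r => dysonPhillips U B n t r ((B r).val (U r s u)))
        volume s t) ∧
      Summable (fun n => dysonPhillips U B n t s u)) ∧
    -- the evolution semigroups are bounded operators given by their formulas
    (∀ t : ℝ, 0 ≤ t → IsGivenBy (T₀ t) (evolutionFormula (fun t s u => U t s u) t)) ∧
    (∀ t : ℝ, 0 ≤ t → IsGivenBy (T t) (evolutionFormula (perturbedFamily U B) t)) ∧
    IsC0Semigroup T₀ ∧ IsC0Semigroup T ∧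
    -- so are the operators `𝔅_l`
    (∀ l : ℝ, 0 < l → IsGivenBy (resolventPerturbation U B l) (resolventFormula U B l) ∧
      ∀ f : LiftedSpace E, ∀ᵐ s ∂halfLineMeasure,
        IntervalIntegrable (fun τ => Real.exp (-l * (s - τ)) • (B s).val (U s τ (f τ)))
          volume 0 s) ∧
    -- the functional extending the norm of `X₊` exists and is unique
    (∃! Ψ : LiftedSpace E →L[ℝ] ℝ, ∀ f ∈ liftedCone E, Ψ f = ‖f‖) ∧
    -- the claims about `B̂ = G - Z`
    ∃ hZG : Z.domain ≤ G.domain, ∀ Bhat : LiftedSpace E →ₗ.[ℝ] LiftedSpace E,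
      Bhat = differenceOperator G Z hZG →
      IsRelativelyBounded Bhat Z ∧
      (∀ f ∈ Z.domain, Tendsto (fun l : ℝ => l • resolventPerturbation U B l f) atTop
        (𝓝 (Bhat.val f))) ∧
      (∀ f ∈ Z.domain, f ∈ liftedCone E → Bhat.val f ∈ liftedCone E) ∧
      (∀ Ψ : LiftedSpace E →L[ℝ] ℝ, (∀ f ∈ liftedCone E, Ψ f = ‖f‖) →
        ∀ f ∈ Z.domain, f ∈ liftedCone E → Ψ (Z.val f + Bhat.val f) ≤ 0) ∧
      (∀ f ∈ Z.domain, ∀ t : ℝ, 0 ≤ t →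
        (∀ s : ℝ, 0 ≤ s → T₀ s f ∈ Z.domain) ∧
        IntervalIntegrable (fun s => T (t - s) (Bhat.val (T₀ s f))) volume 0 t ∧
        T t f = T₀ t f + ∫ s in (0 : ℝ)..t, T (t - s) (Bhat.val (T₀ s f))) := by
  obtain ⟨M, hM⟩ := exists_hasDecomposition hE.generating
  have hU := hUB.isMeasurableEvolution hM
  have hV := hUB.perturbedFamily_isMeasurableEvolution hM
  subst hT₀ hT hZ hG
  have hbV := fun t (ht : (0 : ℝ) ≤ t) => hV.norm_evolutionSemigroup_le ht
  have hdom : (generator (evolutionSemigroup fun t s u => U t s u)).domain ≤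
      (generator (evolutionSemigroup (perturbedFamily U B))).domain := fun f hf =>
    (hasGeneratorValue_perturbed hUB hmeas hM one_pos (hasGeneratorValue_val hf)).mem_domain
  refine ⟨fun t s hs hst u => ⟨fun n => ?_, hUB.summable_dysonPhillips hM hs hst u⟩,
    fun t ht => hU.isGivenBy ht, fun t ht => hV.isGivenBy ht, hU.isC0Semigroup, hV.isC0Semigroup,
    fun l hl => ⟨resolventPerturbation_isGivenBy hUB hmeas hM hl.le,
      intervalIntegrable_resolventFormula hUB hmeas hM hl.le⟩,
    hE.existsUnique_lifted_functional hM, hdom, ?_⟩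
  · exact (hUB.dysonPhillips_isSubstochasticFamily hM n).intervalIntegrable_comp hUB hM hs le_rfl
      hst le_rfl u
  rintro Bhat rfl
  set Z := generator (evolutionSemigroup fun t s u => U t s u)
  set G := generator (evolutionSemigroup (perturbedFamily U B))
  have hval : ∀ f ∈ Z.domain, (differenceOperator G Z hdom).val f = G.val f - Z.val f := by
    intro f hf
    rw [LinearPMap.val_of_mem _ (show f ∈ (differenceOperator G Z hdom).domain from hf),
      LinearPMap.val_of_mem _ hf, LinearPMap.val_of_mem _ (hdom hf)]
    rfl
  have hB : ∀ l : ℝ, 0 < l → ∀ f z,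
      HasGeneratorValue (evolutionSemigroup fun t s u => U t s u) f z →
      (differenceOperator G Z hdom).val f = resolventPerturbation U B l (l • f - z) := by
    intro l hl f z hf
    rw [hval f hf.mem_domain, hf.val_eq, (hasGeneratorValue_perturbed hUB hmeas hM hl hf).val_eq,
      add_sub_cancel_left]
  have hlim : ∀ f ∈ Z.domain, Tendsto (fun l : ℝ => l • resolventPerturbation U B l f) atTop
      (𝓝 ((differenceOperator G Z hdom).val f)) := by
    intro f hf
    -- `l 𝔅_l f = B̂ f + 𝔅_l Z f`, and the last term vanishes in the limit.
    have h0 := (tendsto_resolventPerturbation hUB hmeas hM (Z.val f)).const_add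
      ((differenceOperator G Z hdom).val f)
    rw [add_zero] at h0
    refine h0.congr' ?_
    filter_upwards [eventually_gt_atTop 0] with l hl
    rw [hB l hl f _ (hasGeneratorValue_val hf), map_sub, map_smul, sub_add_cancel]
  refine ⟨⟨le_rfl, ‖resolventPerturbation U B 1‖, ‖resolventPerturbation U B 1‖, norm_nonneg _,
    norm_nonneg _, fun f hf => ?_⟩, hlim, fun f hf hfp => ?_, fun Ψ hΨ f hf hfp => ?_,
    fun f hf t ht => ?_⟩
  · rw [hB 1 one_pos f _ (hasGeneratorValue_val hf), one_smul, ← mul_add, add_comm]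
    exact (ContinuousLinearMap.le_opNorm _ _).trans
      (mul_le_mul_of_nonneg_left (norm_sub_le _ _) (norm_nonneg _))
  · refine isClosed_liftedCone.mem_of_tendsto (hlim f hf) ?_
    filter_upwards [eventually_ge_atTop 0] with l hl
    filter_upwards [resolventPerturbation_mem_liftedCone hUB hmeas hM hl hfp,
      Lp.coeFn_smul l (resolventPerturbation U B l f)] with s h1 h2
    rw [h2, Pi.smul_apply]
    exact smul_nonneg hl h1
  · rw [hval f hf, add_sub_cancel]
    refine le_of_tendsto ((Ψ.continuous.tendsto _).comp (hasGeneratorValue_val (hdom hf))) ?_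
    filter_upwards [self_mem_nhdsWithin] with t ht
    have ht : 0 < t := ht
    rw [Function.comp_apply, map_smul, map_sub, hΨ f hfp, hΨ _
      (hV.evolutionSemigroup_mem_liftedCone
        (fun _ _ hs hst _ => hUB.perturbedFamily_nonneg hM hs hst) ht.le hfp), smul_eq_mul]
    exact mul_nonpos_of_nonneg_of_nonpos (inv_nonneg.2 ht.le) (sub_nonpos.2
      (hV.norm_evolutionSemigroup_le_of_mem
        (fun _ _ hs hst _ => hUB.norm_perturbedFamily_le_of_nonneg hM hs hst) ht.le hfp))
  · have hz : ∀ s : ℝ, 0 ≤ s → HasGeneratorValue (evolutionSemigroup fun t s u => U t s u)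
        (evolutionSemigroup (fun t s u => U t s u) s f)
        (evolutionSemigroup (fun t s u => U t s u) s (Z.val f)) := fun s hs =>
      hU.isC0Semigroup.hasGeneratorValue_apply (hasGeneratorValue_val hf) hs
    -- Since `T₀` commutes with `1 - Z`, the function `s ↦ B̂ T₀(s) f` is continuous.
    have hw : ∀ s : ℝ, 0 ≤ s → (differenceOperator G Z hdom).val
        (evolutionSemigroup (fun t s u => U t s u) s f) = resolventPerturbation U B 1
          (evolutionSemigroup (fun t s u => U t s u) s (f - Z.val f)) := fun s hs => by
      rw [hB 1 one_pos _ _ (hz s hs), one_smul, ← map_sub]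
    refine ⟨fun s hs => (hz s hs).mem_domain, hU.isC0Semigroup.duhamel hV.isC0Semigroup hbV
      (w := fun s => (differenceOperator G Z hdom).val
        (evolutionSemigroup (fun t s u => U t s u) s f)) ?_ (fun s hs => ⟨_, hz s hs, ?_⟩) ht⟩
    · exact ((resolventPerturbation U B 1).continuous.comp_continuousOn
        (hU.isC0Semigroup.continuousOn (f - Z.val f))).congr hw
    · have := hasGeneratorValue_perturbed hUB hmeas hM one_pos (hz s hs)
      rwa [← hB 1 one_pos _ _ (hz s hs)] at this
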